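/- **Setting.** Let $\mathbb M$ be a finite triangulated simplicial complex in $\mathbb R^d$, together with finitely many closed *boundary facets* $F\subset\mathbb R^d$ (untriangulated regions; the vertices of $F$ are the vertices of $\mathbb M$ in $F$). Let $f$ be a piecewise-linear function on $\mathbb M$ and its boundary facets: $f$ is linear on every simplex and constant on every boundary facet. Assume that $f$ is boundary critical, i.e. for each boundary facet $F$, either all neighbours outside $F$ of vertices of $F$ are strictly higher than $F$ or all are strictly lower, and that two distinct vertices have distinct heights unless they lie in a common boundary facet. All vertices of one boundary facet are regarded as a single vertex; the 1-skeleton is the graph with these vertices and the edges of $\mathbb M$ between different ones. The Morse up-degree (down-degree) of $x$ is the number of connected components of the level set $\{f=f(x)+\delta\}$ (resp. $\{f=f(x)-\delta\}$) in the ball $B_\varepsilon(x)$, for $\varepsilon$ small and $\delta$ small with respect to $\varepsilon$. A point is regular if both degrees are $1$, and critical otherwise; a maximum has up-degree $0$ (for a boundary facet: all its vertices have up-degree $0$). $\mathcal V(\mathbb M)$ is the set of critical points and $X\subseteq\mathcal V(\mathbb M)$ the set of maxima. For a vertex $v$, $\mathbb M^+_v$ is the complex induced on the vertices higher than $v$.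 The *join tree* $\mathcal J(\mathbb M)$ is the directed graph on $\mathcal V(\mathbb M)$ with an edge $(u,v)$ whenever $u$ is the lowest critical point in a connected component of $\mathbb M^+_v$ and $v$ is adjacent to a vertex of this component. A *painting* is a coloring $\chi:X\cup E\to\{1,\dots,|X|\}$ of the maxima and of the edges $E$ of the 1-skeleton such that each edge $e$ is reached from some maximum $x$ by a descending path of edges which all, $e$ included, have the color of $x$; it is *initial* if it is a bijection on $X$. An *up-star* of $v$ is the set of all edges joining $v$ to one component of $\mathbb M_v^+$ (if non-empty). $col(v)$ is the set of colors of edges with lower endpoint $v$, together with $\chi(v)$ if $v$ is a maximum. **The procedure $\mathtt{build}(\mathbb M)$** keeps a max-heap $T(c)$ of critical points, keyed by height, for each color $c$, a union-find structure $rep$ on the colors, a critical point $att(c)$ for each color $c$, and a stack $K$. *Initialization.* 1. Construct an initial painting $\chi$: as long as there is an uncolored maximum, choose one, give it a new color and run a descending breadth-first search from it, in which exploring a vertex gives the color of the search to all uncolored downward edges at this vertex and puts their lower endpoints into the queue. 2. Determine the critical points; mark the maxima as processed and the other critical points as unprocessed. 3. For each critical point $v$ and each up-star of $v$ choose a color of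 some edge in this up-star, and insert $v$ into the heap of this color. 4. Set $rep(c)=c$ and let $att(c)$ be the maximum of color $c$; let $K$ and the output be empty. *Main loop.* While there are unprocessed critical points: 1. If $K$ is empty, push any unprocessed critical point. Call the head $h$ of $K$ *ripe* if for every $c\in col(h)$, $h$ is present in $T(rep(c))$ and is its highest element. While the head $h$ is not ripe, choose $c\in col(h)$ such that $h$ is not the highest element present in $T(rep(c))$, and push the highest element of $T(rep(c))$ onto $K$. Then pop the ripe head $h$. 2. Let $cur(h)=\{rep(c): c\in col(h)\}$. For all $c\in cur(h)$, add the edge $(att(c),h)$ to the output and delete $h$ from $T(c)$. 3. Merge the heaps $T(c)$, $c\in cur(h)$; unite the classes of the colors in $cur(h)$ into one class, whose representative $\widehat c$ is any member of $cur(h)$ and which gets the merged heap; set $att(\widehat c)=h$ and mark $h$ as processed. **Theorem.** For every such $\mathbb M$ and whatever choices are made, $\mathtt{build}(\mathbb M)$ terminates, never reaching a step that cannot be carried out, and its output is exactly the join tree $\mathcal J(\mathbb M)$. -/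

import Mathlib

/-- A finite triangulated simplicial complex `M` in `ℝ^d` together with designated boundary facets
and a continuous piecewise-linear height function.  A boundary facet is a closed region of `ℝ^d`,
not itself triangulated, on which the height is constant; its vertices are the vertices of the
triangulation that it contains.  The function is given on the union of the simplices and the
boundary facets; the values of `height` elsewhere are irrelevant. -/
structure PLComplex (d : ℕ) where
  /-- the simplices -/
  complex : Geometry.SimplicialComplex ℝ (EuclideanSpace ℝ (Fin d))
  finite_faces : complex.faces.Finite
  /-- the boundary facets -/
  boundary : Set (Set (EuclideanSpace ℝ (Fin d)))
  finite_boundary : boundary.Finite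
  isClosed_of_mem_boundary : ∀ F ∈ boundary, IsClosed F
  /-- the height function `f` -/
  height : EuclideanSpace ℝ (Fin d) → ℝ
  /-- on every simplex, `f` is obtained from its values at the vertices by linear interpolation -/
  height_interpolates : ∀ s ∈ complex.faces, ∀ w : EuclideanSpace ℝ (Fin d) → ℝ,
    (∀ x ∈ s, 0 ≤ w x) → ∑ x ∈ s, w x = 1 → height (∑ x ∈ s, w x • x) = ∑ x ∈ s, w x * height x
  /-- `f` is constant on every boundary facet -/
  height_boundary : ∀ F ∈ boundary, ∀ x ∈ F, ∀ y ∈ F, height x = height y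
  /-- `f` is boundary critical: the neighbours of a boundary facet are all strictly higher than the
  facet or all strictly lower -/
  boundary_critical : ∀ F ∈ boundary,
    (∀ x ∈ F, ∀ y ∉ F, x ∈ complex.vertices → {x, y} ∈ complex.faces → height x < height y) ∨
    (∀ x ∈ F, ∀ y ∉ F, x ∈ complex.vertices → {x, y} ∈ complex.faces → height y < height x)
  /-- the vertices have distinct heights, except for the vertices of one boundary facet -/
  height_distinct : ∀ x ∈ complex.vertices, ∀ y ∈ complex.vertices, height x = height y →
    x = y ∨ ∃ F ∈ boundary, x ∈ F ∧ y ∈ F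

namespace PLComplex

open Filter Topology

variable {d : ℕ} (M : PLComplex d)

/-! ### Morse degrees and critical points -/

/-- The set on which the height function is given. -/
def domain : Set (EuclideanSpace ℝ (Fin d)) := M.complex.space ∪ ⋃₀ M.boundary

/-- The number of `h`-contours (connected components of the level set at value `h`) of the
restriction of `f` to the ball of radius `ε` around `x`. -/
noncomputable def localContours (x : EuclideanSpace ℝ (Fin d)) (ε h : ℝ) : ℕ∞ :=
  ENat.card (ConnectedComponents {y // y ∈ M.domain ∩ Metric.ball x ε ∧ M.height y = h})

/-- The Morse up-degree of `x` is `k`: for all small `ε` and all `δ` small with respect to `ε`,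
there are exactly `k` contours at value `f x + δ` in the `ε`-ball around `x`. -/
def HasMorseUpDegree (x : EuclideanSpace ℝ (Fin d)) (k : ℕ∞) : Prop :=
  ∀ᶠ ε in 𝓝[>] (0 : ℝ), ∀ᶠ δ in 𝓝[>] (0 : ℝ), M.localContours x ε (M.height x + δ) = k

/-- The Morse down-degree of `x` is `k`. -/
def HasMorseDownDegree (x : EuclideanSpace ℝ (Fin d)) (k : ℕ∞) : Prop :=
  ∀ᶠ ε in 𝓝[>] (0 : ℝ), ∀ᶠ δ in 𝓝[>] (0 : ℝ), M.localContours x ε (M.height x - δ) = k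

/-- A regular point has Morse up-degree and Morse down-degree `1`. -/
def IsRegularPoint (x : EuclideanSpace ℝ (Fin d)) : Prop :=
  M.HasMorseUpDegree x 1 ∧ M.HasMorseDownDegree x 1

/-! ### The 1-skeleton

All vertices of one boundary facet are regarded as a single vertex. -/

/-- Two vertices are identified if they are equal or lie in the same boundary facet. -/
def vertexSetoid : Setoid M.complex.vertices where
  r x y := x = y ∨ ∃ F ∈ M.boundary, (x : EuclideanSpace ℝ (Fin d)) ∈ F ∧ ↑y ∈ F
  iseqv := by
    have key : ∀ x y : M.complex.vertices,
        (x = y ∨ ∃ F ∈ M.boundary, (x : EuclideanSpace ℝ (Fin d)) ∈ F ∧ ↑y ∈ F) ↔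
          M.height x = M.height y := by
      intro x y
      constructor
      · rintro (rfl | ⟨F, hF, hx, hy⟩)
        · rfl
        · exact M.height_boundary F hF _ hx _ hy
      · intro h
        exact (M.height_distinct x x.2 y y.2 h).imp_left Subtype.ext
    simp only [key]
    exact ⟨fun _ => rfl, fun h => h.symm, fun h h' => h.trans h'⟩

/-- The vertices of the 1-skeleton. -/
abbrev Vertex : Type := Quotient M.vertexSetoid

/-- The height of a vertex of the 1-skeleton. -/
def vertexHeight : M.Vertex → ℝ :=
  Quotient.lift (fun x : M.complex.vertices => M.height x) (by
    rintro x y (rfl | ⟨F, hF, hx, hy⟩)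
    · rfl
    · exact M.height_boundary F hF _ hx _ hy)

/-- The 1-skeleton. -/
def skeleton : SimpleGraph M.Vertex where
  Adj u v := u ≠ v ∧ ∃ x y : M.complex.vertices, (Quotient.mk _ x : M.Vertex) = u ∧
    (Quotient.mk _ y : M.Vertex) = v ∧
    ({(x : EuclideanSpace ℝ (Fin d)), ↑y} : Finset _) ∈ M.complex.faces
  symm := ⟨by
    rintro u v ⟨h, x, y, hx, hy, hxy⟩
    exact ⟨h.symm, y, x, hy, hx, by rwa [Finset.pair_comm]⟩⟩
  loopless := ⟨fun _ h => h.1 rfl⟩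

/-- A vertex of the 1-skeleton is critical if it is, or contains, a critical (non-regular) point. -/
def IsCritical (v : M.Vertex) : Prop :=
  ∃ x : M.complex.vertices, (Quotient.mk _ x : M.Vertex) = v ∧ ¬ M.IsRegularPoint x

/-- A vertex of the 1-skeleton is a maximum if it is a point of Morse up-degree `0`, or if the
vertices of the boundary facet that it stands for all have Morse up-degree `0`. -/
def IsMaximum (v : M.Vertex) : Prop :=
  ∀ x : M.complex.vertices, (Quotient.mk _ x : M.Vertex) = v → M.HasMorseUpDegree x 0

theorem IsMaximum.isCritical {M : PLComplex d} {v : M.Vertex} (hv : M.IsMaximum v) :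
    M.IsCritical v := by
  obtain ⟨x, hx⟩ := Quotient.exists_rep v
  refine ⟨x, hx, fun hr => ?_⟩
  obtain ⟨ε, h0, h1⟩ := ((hv x hx).and hr.1).exists
  obtain ⟨δ, h0, h1⟩ := (h0.and h1).exists
  rw [h0] at h1
  exact zero_ne_one h1

/-- The critical points `𝒱(M)`. -/
abbrev CriticalPoint : Type := {v : M.Vertex // M.IsCritical v}

/-- The maxima `X`. -/
abbrev Maximum : Type := {v : M.Vertex // M.IsMaximum v}

/-- A maximum, as a critical point. -/
def Maximum.toCritical {M : PLComplex d} (x : M.Maximum) : M.CriticalPoint :=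
  ⟨x.1, x.2.isCritical⟩

/-! ### The join tree -/

/-- The 1-skeleton of `M⁺_v`, the complex induced on the vertices higher than `v`. -/
abbrev above (v : M.Vertex) : SimpleGraph {u : M.Vertex // M.vertexHeight v < M.vertexHeight u} :=
  M.skeleton.induce {u | M.vertexHeight v < M.vertexHeight u}

/-- The join tree `𝒥(M)` on the critical points: the directed edge `(u, v)` is present when `u` is
the lowest critical point in a connected component of `M⁺_v` and `v` is adjacent to a vertex in
this component. -/
def joinTree : Digraph M.CriticalPoint where
  Adj u v := ∃ C : (M.above v.1).ConnectedComponent,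
    (∃ hu : M.vertexHeight v.1 < M.vertexHeight u.1, ⟨u.1, hu⟩ ∈ C.supp) ∧
    (∀ w : M.CriticalPoint, ∀ hw : M.vertexHeight v.1 < M.vertexHeight w.1,
      ⟨w.1, hw⟩ ∈ C.supp → M.vertexHeight u.1 ≤ M.vertexHeight w.1) ∧
    ∃ y ∈ C.supp, M.skeleton.Adj v.1 y.1

/-! ### Paintings -/

/-- An edge of the 1-skeleton, with its upper and its lower endpoint. -/
@[ext]
structure Edge where
  upper : M.Vertex
  lower : M.Vertex
  adj : M.skeleton.Adj upper lower
  lt : M.vertexHeight lower < M.vertexHeight upper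

/-- The colors `[|X|]`. -/
abbrev Color : Type := Fin (Nat.card M.Maximum)

/-- A painting: every edge `e` is reached from some maximum `x` by a descending path of edges that
all have, like `e` itself, the color of `x`. -/
structure Painting where
  maxColor : M.Maximum → M.Color
  edgeColor : M.Edge → M.Color
  exists_path : ∀ e : M.Edge, ∃ x : M.Maximum, edgeColor e = maxColor x ∧
    Relation.ReflTransGen
      (fun u v => ∃ a : M.Edge, a.upper = u ∧ a.lower = v ∧ edgeColor a = maxColor x) x.1 e.upper

/-- An initial painting gives the maxima distinct colors, and uses every color. -/
structure InitialPainting extends Painting M where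
  bijective : Function.Bijective maxColor

/-- The up-stars of `v`: for each component of `M⁺_v` to which `v` is connected, the set of all
edges that connect `v` to it. -/
def IsUpStar (v : M.Vertex) (U : Set M.Edge) : Prop :=
  U.Nonempty ∧ ∃ C : (M.above v).ConnectedComponent,
    U = {e | e.lower = v ∧ ∃ y ∈ C.supp, e.upper = y.1}

/-- `col(v)`: the colors that touch `v`. -/
def Painting.col {M : PLComplex d} (χ : M.Painting) (v : M.Vertex) : Set M.Color :=
  {c | (∃ e : M.Edge, e.lower = v ∧ χ.edgeColor e = c) ∨
    ∃ x : M.Maximum, x.1 = v ∧ χ.maxColor x = c}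

/-! ### Constructing an initial painting by descending breadth-first searches -/

/-- The state of the painting phase: the colors given so far, and the first-in-first-out queue of
the current search, whose entries carry the color of that search. -/
structure PaintState where
  maxColor : M.Maximum → Option M.Color
  edgeColor : M.Edge → Option M.Color
  queue : List (M.Vertex × M.Color)

open Classical in
/-- One step of the painting phase. -/
inductive PaintStep : M.PaintState → M.PaintState → Prop
  /-- When no search is running, an arbitrary uncolored maximum gets a fresh color and a search is
  started from it. -/
  | pour (s : M.PaintState) (x : M.Maximum) (c : M.Color) (hq : s.queue = [])
      (hx : s.maxColor x = none) (hc : ∀ y, s.maxColor y ≠ some c) :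
      PaintStep s { s with maxColor := Function.update s.maxColor x (some c), queue := [(x.1, c)] }
  /-- The first vertex of the queue is explored: its uncolored downward edges are colored, and
  their lower endpoints join the queue, in any order. -/
  | spread (s : M.PaintState) (v : M.Vertex) (c : M.Color) (q : List (M.Vertex × M.Color))
      (es : List M.Edge) (hq : s.queue = (v, c) :: q) (hnd : es.Nodup)
      (hes : ∀ e, e ∈ es ↔ e.upper = v ∧ s.edgeColor e = none) :
      PaintStep s { s with
        edgeColor := fun e => if e ∈ es then some c else s.edgeColor e
        queue := q ++ es.map fun e => (e.lower, c) }

/-! ### The procedure `build` -/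

/-- The variables of `build`.  A heap, keyed by the heights, is represented by its set of elements,
and the union-find structure on the colors by the map to the representatives. -/
structure BuildState where
  heap : M.Color → Set M.CriticalPoint
  rep : M.Color → M.Color
  att : M.Color → M.CriticalPoint
  stack : List M.CriticalPoint
  processed : Set M.CriticalPoint
  output : Digraph M.CriticalPoint

/-- `v` is present in the heap `T` and is its highest element. -/
def IsHighest (v : M.CriticalPoint) (T : Set M.CriticalPoint) : Prop :=
  v ∈ T ∧ ∀ w ∈ T, M.vertexHeight w.1 ≤ M.vertexHeight v.1

/-- The result of steps 2-6 of `init`: for each critical point `v` and each up-star of `v` some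
color `pick v U` of this up-star is chosen, and `v` is inserted into the heap of this color; every
color is its own representative and is attached to the maximum of this color; the stack and the
output are empty.  The maxima count as processed from the start. -/
def IsInitialized {M : PLComplex d} (χ : M.InitialPainting) (s : M.BuildState) : Prop :=
  (∃ pick : M.CriticalPoint → Set M.Edge → M.Color,
    (∀ v U, M.IsUpStar v.1 U → pick v U ∈ χ.edgeColor '' U) ∧
    ∀ c, s.heap c = {v | ∃ U, M.IsUpStar v.1 U ∧ pick v U = c}) ∧
  (∀ c, s.rep c = c) ∧
  (∀ x : M.Maximum, s.att (χ.maxColor x) = x.toCritical) ∧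
  s.stack = [] ∧
  s.processed = {v | M.IsMaximum v.1} ∧
  s.output = { Adj := fun _ _ => False }

/-- A critical point is ripe if it is the highest element of the heap of `rep c` for every color
`c` that touches it. -/
def IsRipe {M : PLComplex d} (χ : M.InitialPainting) (s : M.BuildState)
    (v : M.CriticalPoint) : Prop :=
  ∀ c ∈ χ.col v.1, M.IsHighest v (s.heap (s.rep c))

/-- `cur(h)`: the representatives of the colors that touch `h`. -/
def cur {M : PLComplex d} (χ : M.InitialPainting) (s : M.BuildState)
    (h : M.CriticalPoint) : Set M.Color :=
  s.rep '' χ.col h.1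

open Classical in
/-- Processing `h`, where `C = cur(h)` and `c₀` is the resulting color of the union: the edges
`(att c, h)` for `c ∈ C` are added to the output, `h` is deleted from the heaps of the colors in
`C`, these heaps are merged, the classes of the colors in `C` are united to one class with
representative `c₀`, which is attached to `h`, and `h` is marked as processed. -/
noncomputable def BuildState.process {M : PLComplex d} (s : M.BuildState) (h : M.CriticalPoint)
    (C : Set M.Color) (c₀ : M.Color) : M.BuildState where
  heap c := if c = c₀ then ⋃ c' ∈ C, s.heap c' \ {h} else if c ∈ C then ∅ else s.heap c
  rep c := if s.rep c ∈ C then c₀ else s.rep c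
  att := Function.update s.att c₀ h
  stack := s.stack
  processed := insert h s.processed
  output := { Adj := fun u v => s.output.Adj u v ∨ (v = h ∧ ∃ c ∈ C, s.att c = u) }

/-- The configurations of a run of `build`: a control point and the values of the variables. -/
inductive Config
  /-- step 1 of `init` is being executed -/
  | painting (s : M.PaintState)
  /-- step 1 of `init` has returned the initial painting `χ` -/
  | painted (χ : M.InitialPainting)
  /-- at the test of the main loop of `build` -/
  | main (χ : M.InitialPainting) (s : M.BuildState)
  /-- at the test of the loop of `update` -/
  | update (χ : M.InitialPainting) (s : M.BuildState)
  /-- `update` has returned and `h` has been popped from the stack -/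
  | popped (χ : M.InitialPainting) (s : M.BuildState) (h : M.CriticalPoint)
  /-- `build` has returned -/
  | halted (J : Digraph M.CriticalPoint)

/-- The configuration in which `build` starts: nothing is painted. -/
def Config.start : M.Config :=
  .painting { maxColor := fun _ => none, edgeColor := fun _ => none, queue := [] }

/-- One step of `build`.  Wherever the procedure leaves a choice open, all choices are allowed. -/
inductive Step : M.Config → M.Config → Prop
  | paint (s s' : M.PaintState) (hs : M.PaintStep s s') : Step (.painting s) (.painting s')
  /-- no search is running and everything is colored: the colors are returned as an initial
  painting -/
  | painted (s : M.PaintState) (χ : M.InitialPainting) (hq : s.queue = [])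
      (hx : ∀ x, s.maxColor x = some (χ.maxColor x))
      (he : ∀ e, s.edgeColor e = some (χ.edgeColor e)) :
      Step (.painting s) (.painted χ)
  | init (χ : M.InitialPainting) (s : M.BuildState) (hs : IsInitialized χ s) :
      Step (.painted χ) (.main χ s)
  /-- the main loop ends when all critical points are processed -/
  | finish (χ : M.InitialPainting) (s : M.BuildState) (hs : ∀ v, v ∈ s.processed) :
      Step (.main χ s) (.halted s.output)
  /-- `update` is called with an empty stack: an arbitrary unprocessed critical point is pushed -/
  | callEmpty (χ : M.InitialPainting) (s : M.BuildState) (v : M.CriticalPoint)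
      (hv : v ∉ s.processed) (hs : s.stack = []) :
      Step (.main χ s) (.update χ { s with stack := [v] })
  /-- `update` is called with a non-empty stack -/
  | call (χ : M.InitialPainting) (s : M.BuildState) (v : M.CriticalPoint)
      (hv : v ∉ s.processed) (hs : s.stack ≠ []) :
      Step (.main χ s) (.update χ s)
  /-- the head `h` of the stack is not ripe: for a color `c` touching `h` such that `h` is not the
  highest element of the heap of `rep c`, the highest element `w` of that heap is pushed -/
  | push (χ : M.InitialPainting) (s : M.BuildState) (h w : M.CriticalPoint)
      (K : List M.CriticalPoint) (c : M.Color) (hs : s.stack = h :: K) (hc : c ∈ χ.col h.1)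
      (hh : ¬ M.IsHighest h (s.heap (s.rep c))) (hw : M.IsHighest w (s.heap (s.rep c))) :
      Step (.update χ s) (.update χ { s with stack := w :: h :: K })
  /-- the head `h` of the stack is ripe: `update` returns and `h` is popped -/
  | pop (χ : M.InitialPainting) (s : M.BuildState) (h : M.CriticalPoint)
      (K : List M.CriticalPoint) (hs : s.stack = h :: K) (hh : IsRipe χ s h) :
      Step (.update χ s) (.popped χ { s with stack := K } h)
  /-- the body of the main loop after the pop; any member of `cur(h)` may become the
  representative of the union -/
  | process (χ : M.InitialPainting) (s : M.BuildState) (h : M.CriticalPoint) (c₀ : M.Color)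
      (hc₀ : c₀ ∈ cur χ s h) :
      Step (.popped χ s h) (.main χ (s.process h (cur χ s h) c₀))

end PLComplex

namespace PLComplex

open Filter Topology

variable {d : ℕ} (M : PLComplex d)

/-! ### The height function on faces -/

/-! Geometry enters through two facts only. A vertex of the 1-skeleton is a maximum iff it has no
higher neighbour (`isMaximum_iff`), and at a non-critical vertex `v` all ascending edges lead to one
component of `M⁺_v` (`reachableIn_of_not_isCritical`). Everything else concerns a finite graph with
injective heights. As the threshold sinks, superlevel components merge only at critical vertices
(`exists_merge`), so all maxima of a component of `M⁺_v` lie over its lowest critical point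
(`exists_lowest`).

The main loop uses a painting only through this: the color of an ascending edge names a maximum in
the component to which the edge leads. The invariant `Sound` says that the processed points are
closed upwards and that each color class consists of the maxima over its attached point. Hence the
maxima of a completely processed component share one class, and it does not matter which color was
picked for an up-star.

The crux is `exists_mem_heap`. Suppose an edge ascends from an unprocessed `h` to a component with
an unprocessed point, and let `a` be the attached point of its color class. Among the unprocessed
points above `h` that have `a` over them, take the highest, `z`. The component of `M⁺_z` containing
`a` is completely processed, so `z` is in the heap of that class, above `h`. Therefore a ripe `h`
sees only processed components, each class is attached to the lowest critical point of its
component, and the edges added are those of the join tree. If `h` is not ripe, a strictly higher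
point is pushed (`exists_isHighest`). The stack thus increases strictly in height, which bounds its
length and makes `Config.potential` decrease. No configuration satisfying the invariant is stuck
before the join tree is returned (`Config.Sound.exists_step`). -/

theorem exists_weights_of_mem_convexHull {s : Finset (EuclideanSpace ℝ (Fin d))}
    (hs : s ∈ M.complex.faces) {p : EuclideanSpace ℝ (Fin d)}
    (hp : p ∈ convexHull ℝ (s : Set (EuclideanSpace ℝ (Fin d)))) :
    ∃ w : EuclideanSpace ℝ (Fin d) → ℝ, (∀ x ∈ s, 0 ≤ w x) ∧ ∑ x ∈ s, w x = 1 ∧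
      M.height p = ∑ x ∈ s, w x * M.height x := by
  obtain ⟨w, h0, h1, rfl⟩ := Finset.mem_convexHull'.1 hp
  exact ⟨w, h0, h1, M.height_interpolates s hs w h0 h1⟩

theorem height_le_of_mem_convexHull {s : Finset (EuclideanSpace ℝ (Fin d))}
    (hs : s ∈ M.complex.faces) {p : EuclideanSpace ℝ (Fin d)}
    (hp : p ∈ convexHull ℝ (s : Set (EuclideanSpace ℝ (Fin d)))) {c : ℝ}
    (h : ∀ y ∈ s, M.height y ≤ c) : M.height p ≤ c := by
  obtain ⟨w, h0, h1, hw⟩ := M.exists_weights_of_mem_convexHull hs hp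
  calc M.height p = ∑ x ∈ s, w x * M.height x := hw
    _ ≤ ∑ x ∈ s, w x * c := Finset.sum_le_sum fun x hx =>
        mul_le_mul_of_nonneg_left (h x hx) (h0 x hx)
    _ = c := by rw [← Finset.sum_mul, h1, one_mul]

theorem le_height_of_mem_convexHull {s : Finset (EuclideanSpace ℝ (Fin d))}
    (hs : s ∈ M.complex.faces) {p : EuclideanSpace ℝ (Fin d)}
    (hp : p ∈ convexHull ℝ (s : Set (EuclideanSpace ℝ (Fin d)))) {c : ℝ}
    (h : ∀ y ∈ s, c ≤ M.height y) : c ≤ M.height p := by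
  obtain ⟨w, h0, h1, hw⟩ := M.exists_weights_of_mem_convexHull hs hp
  calc c = ∑ x ∈ s, w x * c := by rw [← Finset.sum_mul, h1, one_mul]
    _ ≤ ∑ x ∈ s, w x * M.height x := Finset.sum_le_sum fun x hx =>
        mul_le_mul_of_nonneg_left (h x hx) (h0 x hx)
    _ = M.height p := hw.symm

theorem pair_mem_faces {s : Finset (EuclideanSpace ℝ (Fin d))} (hs : s ∈ M.complex.faces)
    {x y : EuclideanSpace ℝ (Fin d)} (hx : x ∈ s) (hy : y ∈ s) : {x, y} ∈ M.complex.faces :=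
  M.complex.down_closed hs (by simp [Finset.insert_subset_iff, hx, hy]) (by simp)

theorem mem_vertices_of_mem {s : Finset (EuclideanSpace ℝ (Fin d))} (hs : s ∈ M.complex.faces)
    {x : EuclideanSpace ℝ (Fin d)} (hx : x ∈ s) : x ∈ M.complex.vertices :=
  M.complex.down_closed hs (by simpa using hx) (by simp)

/-! ### Local contours at a vertex -/

/-- Near a vertex, only the faces and boundary facets containing it are present. -/
theorem eventually_mem_face_or_boundary {x : EuclideanSpace ℝ (Fin d)}
    (hx : x ∈ M.complex.vertices) :
    ∀ᶠ ε in 𝓝[>] (0 : ℝ), ∀ p ∈ M.domain ∩ Metric.ball x ε, M.height p = M.height x ∨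
      ∃ s ∈ M.complex.faces, x ∈ s ∧ p ∈ convexHull ℝ (s : Set (EuclideanSpace ℝ (Fin d))) := by
  -- A closed set that misses `x` misses a neighbourhood of `x`; there are only finitely many faces
  -- and boundary facets to avoid.
  have key : ∀ C : Set (EuclideanSpace ℝ (Fin d)), IsClosed C → ∀ᶠ p in 𝓝 x, p ∈ C → x ∈ C := by
    intro C hC
    by_cases h : x ∈ C
    · exact Eventually.of_forall fun _ _ => h
    · filter_upwards [hC.isOpen_compl.mem_nhds h] with p hp hp'
      exact absurd hp' hp
  have h1 : ∀ᶠ p in 𝓝 x, ∀ s ∈ M.complex.faces,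
      p ∈ convexHull ℝ (s : Set (EuclideanSpace ℝ (Fin d))) →
        x ∈ convexHull ℝ (s : Set (EuclideanSpace ℝ (Fin d))) :=
    (eventually_all_finite M.finite_faces).2 fun s _ =>
      key _ (s.finite_toSet.isClosed_convexHull ℝ)
  have h2 : ∀ᶠ p in 𝓝 x, ∀ F ∈ M.boundary, p ∈ F → x ∈ F :=
    (eventually_all_finite M.finite_boundary).2 fun F hF => key F (M.isClosed_of_mem_boundary F hF)
  obtain ⟨r, hr, hball⟩ := Metric.eventually_nhds_iff_ball.1 (h1.and h2)
  filter_upwards [Ioo_mem_nhdsGT hr] with ε hε p hp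
  obtain ⟨hs, hF⟩ := hball p (Metric.ball_subset_ball hε.2.le hp.2)
  rcases hp.1 with hp | ⟨F, hFb, hpF⟩
  · obtain ⟨s, hs', hps⟩ := Geometry.SimplicialComplex.mem_space_iff.1 hp
    exact Or.inr ⟨s, hs', (M.complex.vertex_mem_convexHull_iff hx hs').1 (hs s hs' hps), hps⟩
  · exact Or.inl (M.height_boundary F hFb p hpF x (hF F hFb hpF))

theorem localContours_eq_zero_iff (x : EuclideanSpace ℝ (Fin d)) (ε h : ℝ) :
    M.localContours x ε h = 0 ↔ ∀ p ∈ M.domain ∩ Metric.ball x ε, M.height p ≠ h := by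
  rw [localContours, ENat.card_eq_zero_iff_empty, ConnectedComponents.isEmpty_iff_isEmpty,
    isEmpty_subtype]
  exact ⟨fun H p hp hh => H p ⟨hp, hh⟩, fun H p hp => H p hp.1 hp.2⟩

/-- All vertices of a face at `x` are neighbours of `x`, so by linearity the face nowhere rises
above `x`, and the level sets slightly above `x` are locally empty. -/
theorem hasMorseUpDegree_zero {x : EuclideanSpace ℝ (Fin d)} (hx : x ∈ M.complex.vertices)
    (h : ∀ y, {x, y} ∈ M.complex.faces → M.height y ≤ M.height x) : M.HasMorseUpDegree x 0 := by
  filter_upwards [M.eventually_mem_face_or_boundary hx] with ε hε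
  filter_upwards [self_mem_nhdsWithin] with δ (hδ : 0 < δ)
  rw [localContours_eq_zero_iff]
  intro p hp hh
  rcases hε p hp with h' | ⟨s, hs, hxs, hps⟩
  · linarith
  · have := M.height_le_of_mem_convexHull hs hps fun y hy => h y (M.pair_mem_faces hs hxs hy)
    linarith

theorem hasMorseDownDegree_zero {x : EuclideanSpace ℝ (Fin d)} (hx : x ∈ M.complex.vertices)
    (h : ∀ y, {x, y} ∈ M.complex.faces → M.height x ≤ M.height y) :
    M.HasMorseDownDegree x 0 := by
  filter_upwards [M.eventually_mem_face_or_boundary hx] with ε hε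
  filter_upwards [self_mem_nhdsWithin] with δ (hδ : 0 < δ)
  rw [localContours_eq_zero_iff]
  intro p hp hh
  rcases hε p hp with h' | ⟨s, hs, hxs, hps⟩
  · linarith
  · have := M.le_height_of_mem_convexHull hs hps fun y hy => h y (M.pair_mem_faces hs hxs hy)
    linarith

/-- The contours slightly above `x` meet every edge ascending from `x`. -/
theorem eventually_exists_mem_edge {x y : EuclideanSpace ℝ (Fin d)}
    (hxy : {x, y} ∈ M.complex.faces) (hlt : M.height x < M.height y) {ε : ℝ} (hε : 0 < ε) :
    ∀ᶠ δ in 𝓝[>] (0 : ℝ),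
      ∃ p ∈ convexHull ℝ ((({x, y} : Finset (EuclideanSpace ℝ (Fin d)))) :
        Set (EuclideanSpace ℝ (Fin d))),
        p ∈ Metric.ball x ε ∧ M.height p = M.height x + δ := by
  have hne : x ≠ y := fun h => hlt.ne (by rw [h])
  set D := M.height y - M.height x with hD
  have hD0 : 0 < D := sub_pos.2 hlt
  -- Along the edge the height is linear with total rise `D`, so the level `M.height x + δ` is met
  -- at parameter `δ / D`.
  have hcont : Continuous fun δ : ℝ => (1 - δ / D) • x + (δ / D) • y := by fun_prop
  have hball : ∀ᶠ δ in 𝓝[>] (0 : ℝ), (1 - δ / D) • x + (δ / D) • y ∈ Metric.ball x ε := by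
    refine nhdsWithin_le_nhds (hcont.continuousAt.eventually_mem ?_)
    simpa using Metric.ball_mem_nhds x hε
  filter_upwards [hball, Ioo_mem_nhdsGT hD0] with δ hδ hδD
  have ht0 : 0 ≤ δ / D := (div_pos hδD.1 hD0).le
  have ht1 : 0 ≤ 1 - δ / D := sub_nonneg.2 ((div_le_one hD0).2 hδD.2.le)
  classical
  let w : EuclideanSpace ℝ (Fin d) → ℝ := fun z => if z = x then 1 - δ / D else δ / D
  have hwx : w x = 1 - δ / D := if_pos rfl
  have hwy : w y = δ / D := if_neg hne.symm
  have h0 : ∀ z ∈ ({x, y} : Finset (EuclideanSpace ℝ (Fin d))), 0 ≤ w z := by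
    simp [hwx, hwy, ht0, ht1]
  have h1 : ∑ z ∈ ({x, y} : Finset (EuclideanSpace ℝ (Fin d))), w z = 1 := by
    rw [Finset.sum_pair hne, hwx, hwy]; ring
  have hp : ∑ z ∈ ({x, y} : Finset (EuclideanSpace ℝ (Fin d))), w z • z =
      (1 - δ / D) • x + (δ / D) • y := by
    rw [Finset.sum_pair hne, hwx, hwy]
  refine ⟨_, Finset.mem_convexHull'.2 ⟨w, h0, h1, hp⟩, hδ, ?_⟩
  rw [← hp, M.height_interpolates _ hxy w h0 h1, Finset.sum_pair hne, hwx, hwy]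
  field_simp
  rw [hD]; ring

theorem not_hasMorseUpDegree_zero {x y : EuclideanSpace ℝ (Fin d)}
    (hxy : {x, y} ∈ M.complex.faces) (hlt : M.height x < M.height y) :
    ¬ M.HasMorseUpDegree x 0 := by
  intro h
  obtain ⟨ε, h0, hε⟩ := (h.and self_mem_nhdsWithin).exists
  obtain ⟨δ, h0, p, hp, hpb, hph⟩ := (h0.and (M.eventually_exists_mem_edge hxy hlt hε)).exists
  exact (M.localContours_eq_zero_iff x ε _).1 h0 p
    ⟨Or.inl (M.complex.convexHull_subset_space hxy hp), hpb⟩ hph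

theorem IsRegularPoint.not_hasMorseDownDegree_zero {M : PLComplex d}
    {x : EuclideanSpace ℝ (Fin d)} (hx : M.IsRegularPoint x) : ¬ M.HasMorseDownDegree x 0 := by
  intro h
  obtain ⟨ε, h⟩ := (h.and hx.2).exists
  obtain ⟨δ, h0, h1⟩ := (h.1.and h.2).exists
  rw [h0] at h1
  exact zero_ne_one h1

end PLComplex

/-! ### Reachability within a set of vertices -/

namespace SimpleGraph

variable {V : Type*} (G : SimpleGraph V)

/-- `x` and `y` are joined by a walk that stays in `S`. -/
def ReachableIn (S : Set V) (x y : V) : Prop :=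
  ∃ (hx : x ∈ S) (hy : y ∈ S), (G.induce S).Reachable ⟨x, hx⟩ ⟨y, hy⟩

variable {G} {S T : Set V} {x y z : V}

theorem ReachableIn.refl (hx : x ∈ S) : G.ReachableIn S x x := ⟨hx, hx, Reachable.refl _⟩

theorem ReachableIn.symm (h : G.ReachableIn S x y) : G.ReachableIn S y x :=
  ⟨h.2.1, h.1, h.2.2.symm⟩

theorem ReachableIn.trans (h : G.ReachableIn S x y) (h' : G.ReachableIn S y z) :
    G.ReachableIn S x z :=
  ⟨h.1, h'.2.1, h.2.2.trans h'.2.2⟩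

theorem ReachableIn.mono (h : G.ReachableIn S x y) (hST : S ⊆ T) : G.ReachableIn T x y :=
  ⟨hST h.1, hST h.2.1, h.2.2.map (induceHomOfLE G hST).toHom⟩

theorem Adj.reachableIn (h : G.Adj x y) (hx : x ∈ S) (hy : y ∈ S) : G.ReachableIn S x y :=
  ⟨hx, hy, Adj.reachable (G := G.induce S) h⟩

theorem ReachableIn.induction {P : V → Prop} (h : G.ReachableIn S x y) (hx : P x)
    (step : ∀ a b, a ∈ S → b ∈ S → G.Adj a b → P a → P b) : P y := by
  obtain ⟨hxS, hyS, h⟩ := h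
  rw [reachable_iff_reflTransGen] at h
  have : ∀ b : S, Relation.ReflTransGen (G.induce S).Adj ⟨x, hxS⟩ b → P b := by
    intro b hb
    induction hb with
    | refl => exact hx
    | tail _ hab ih => exact step _ _ (Subtype.property _) (Subtype.property _) hab ih
  exact this _ h

end SimpleGraph

namespace PLComplex

open Filter Topology SimpleGraph

variable {d : ℕ} (M : PLComplex d)

/-! ### Vertices of the 1-skeleton -/

/-- The vertex of the 1-skeleton that a vertex of the complex belongs to. -/
abbrev mkVertex (x : M.complex.vertices) : M.Vertex := Quotient.mk _ x

instance : Finite M.Vertex := by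
  have : M.complex.vertices.Finite := by
    rw [Geometry.SimplicialComplex.vertices_eq]
    exact M.finite_faces.biUnion fun s _ => s.finite_toSet
  have := this.to_subtype
  exact Quotient.finite _

/-- Equal heights are allowed only inside one boundary facet, and such vertices have been
identified. This turns weak height comparisons of different vertices into strict ones throughout. -/
theorem vertexHeight_injective : Function.Injective M.vertexHeight := by
  intro u v
  refine Quotient.inductionOn₂ u v fun x y h => Quotient.sound ?_
  exact (M.height_distinct x x.2 y y.2 h).imp_left Subtype.ext

theorem mkVertex_ne {x y : M.complex.vertices} (h : M.height x ≠ M.height y) :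
    M.mkVertex x ≠ M.mkVertex y := fun hv => h (congrArg M.vertexHeight hv)

theorem adj_mkVertex {x y : M.complex.vertices} (h : M.height x ≠ M.height y)
    (hxy : {(x : EuclideanSpace ℝ (Fin d)), ↑y} ∈ M.complex.faces) :
    M.skeleton.Adj (M.mkVertex x) (M.mkVertex y) :=
  ⟨M.mkVertex_ne h, x, y, rfl, rfl, hxy⟩

theorem exists_pair_of_adj {u v : M.Vertex} (h : M.skeleton.Adj u v) :
    ∃ x y : M.complex.vertices, M.mkVertex x = u ∧ M.mkVertex y = v ∧
      ({(x : EuclideanSpace ℝ (Fin d)), ↑y} : Finset _) ∈ M.complex.faces :=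
  h.2

/-- An ascending edge meets every level slightly above its lower end, and without ascending edges
these levels are locally empty. From here on maxima are purely combinatorial. -/
theorem isMaximum_iff {v : M.Vertex} :
    M.IsMaximum v ↔ ∀ u, M.skeleton.Adj v u → M.vertexHeight u < M.vertexHeight v := by
  constructor
  · intro hv u hu
    by_contra hlt
    have hlt := lt_of_le_of_ne (not_lt.1 hlt) fun h => hu.1 (M.vertexHeight_injective h)
    obtain ⟨x, y, hx, rfl, hxy⟩ := M.exists_pair_of_adj hu
    have := hv x hx
    subst hx
    exact M.not_hasMorseUpDegree_zero hxy hlt this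
  · rintro h x rfl
    refine M.hasMorseUpDegree_zero x.2 fun y hxy => not_lt.1 fun hlt => ?_
    have hy : y ∈ M.complex.vertices := M.mem_vertices_of_mem hxy (by simp)
    exact hlt.asymm (h _ (M.adj_mkVertex (y := ⟨y, hy⟩) hlt.ne hxy))

/-- The vertices of the 1-skeleton higher than `t`. -/
abbrev higher (t : ℝ) : Set M.Vertex := {u | t < M.vertexHeight u}

theorem reachableIn_of_mem_face {s : Finset (EuclideanSpace ℝ (Fin d))}
    (hs : s ∈ M.complex.faces) {y z : M.complex.vertices} (hy : ↑y ∈ s) (hz : ↑z ∈ s) {t : ℝ}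
    (hty : t < M.height y) (htz : t < M.height z) :
    M.skeleton.ReachableIn (M.higher t) (M.mkVertex y) (M.mkVertex z) := by
  by_cases h : M.mkVertex y = M.mkVertex z
  · rw [h]; exact .refl htz
  · exact Adj.reachableIn ⟨h, y, z, rfl, rfl, M.pair_mem_faces hs hy hz⟩ hty htz

/-- If the local contour above `x` is connected, the ascending edges at `x` lead to the same
component of the complex induced on the higher vertices. -/
theorem HasMorseUpDegree.reachableIn {M : PLComplex d} {x y z : M.complex.vertices}
    (hx : M.HasMorseUpDegree x 1)
    (hxy : {(x : EuclideanSpace ℝ (Fin d)), ↑y} ∈ M.complex.faces)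
    (hxz : {(x : EuclideanSpace ℝ (Fin d)), ↑z} ∈ M.complex.faces)
    (hlty : M.height x < M.height y) (hltz : M.height x < M.height z) :
    M.skeleton.ReachableIn (M.higher (M.height x)) (M.mkVertex y) (M.mkVertex z) := by
  obtain ⟨ε, ⟨h1, hnear⟩, hε⟩ := ((hx.and (M.eventually_mem_face_or_boundary x.2)).and
    self_mem_nhdsWithin).exists
  obtain ⟨δ, ⟨⟨h1, p, hp, hpb, hph⟩, q, hq, hqb, hqh⟩, hδ⟩ :=
    ((h1.and (M.eventually_exists_mem_edge hxy hlty hε)).and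
      (M.eventually_exists_mem_edge hxz hltz hε) |>.and self_mem_nhdsWithin).exists
  replace hδ : 0 < δ := hδ
  set L := {y // y ∈ M.domain ∩ Metric.ball (x : EuclideanSpace ℝ (Fin d)) ε ∧
    M.height y = M.height x + δ} with hL
  have hpre : PreconnectedSpace L := by
    rw [preconnectedSpace_iff_connectedComponent]
    have : Subsingleton (ConnectedComponents L) := ENat.card_le_one_iff_subsingleton _ |>.1 h1.le
    intro a
    ext b
    simp only [Set.mem_univ, iff_true]
    exact ConnectedComponents.coe_eq_coe'.1 (Subsingleton.elim _ _)
  have hup : ∀ s ∈ M.complex.faces, ∀ a : L,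
      ↑a ∈ convexHull ℝ (s : Set (EuclideanSpace ℝ (Fin d))) → ∃ b : M.complex.vertices,
        ↑b ∈ s ∧ M.height x < M.height b := by
    intro s hs a ha
    by_contra! H
    have := M.height_le_of_mem_convexHull hs ha
      fun b hb => H ⟨b, M.mem_vertices_of_mem hs hb⟩ hb
    linarith [a.2.2]
  -- `A P` is the part of the contour in faces that have a vertex higher than `x` with property `P`.
  -- For "reachable from `y`" and its negation these are two closed sets covering the connected
  -- contour `L`; their disjointness forces one to be empty.
  obtain ⟨A, hAdef⟩ : ∃ A : (M.Vertex → Prop) → Set L, ∀ P, A P = ⋃ s ∈ {s ∈ M.complex.faces |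
    ∃ b : M.complex.vertices, ↑b ∈ s ∧ M.height x < M.height b ∧ P (M.mkVertex b)},
      {a : L | ↑a ∈ convexHull ℝ (s : Set (EuclideanSpace ℝ (Fin d)))} := ⟨_, fun _ => rfl⟩
  have hA : ∀ P, IsClosed (A P) := fun P => hAdef P ▸
    (M.finite_faces.subset (Set.sep_subset _ _)).isClosed_biUnion fun s _ =>
      (s.finite_toSet.isClosed_convexHull ℝ).preimage continuous_subtype_val
  have memA : ∀ {P} {a : L} {s} {b : M.complex.vertices}, s ∈ M.complex.faces → ↑b ∈ s →
      M.height x < M.height b → P (M.mkVertex b) →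
      ↑a ∈ convexHull ℝ (s : Set (EuclideanSpace ℝ (Fin d))) → a ∈ A P :=
    fun {P} _ _ _ hs hb hlt hP ha => hAdef P ▸ Set.mem_biUnion ⟨hs, _, hb, hlt, hP⟩ ha
  set R := M.skeleton.ReachableIn (M.higher (M.height x)) (M.mkVertex y) with hR
  have hcover : A R ∪ A (fun b => ¬ R b) = Set.univ := by
    refine Set.eq_univ_of_forall fun a => ?_
    rcases hnear a a.2.1 with h | ⟨s, hs, -, ha⟩
    · linarith [a.2.2]
    · obtain ⟨b, hb, hlt⟩ := hup s hs a ha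
      by_cases hRb : R (M.mkVertex b)
      · exact Or.inl (memA hs hb hlt hRb ha)
      · exact Or.inr (memA hs hb hlt hRb ha)
  have hdisj : Disjoint (A R) (A (fun b => ¬ R b)) := by
    rw [Set.disjoint_left]
    intro a ha ha'
    rw [hAdef] at ha ha'
    obtain ⟨s, ⟨hs, b, hbs, hlt, hb⟩, has⟩ := Set.mem_iUnion₂.1 ha
    obtain ⟨s', ⟨hs', b', hbs', hlt', hb'⟩, has'⟩ := Set.mem_iUnion₂.1 ha'
    -- A point of the contour in two faces lies in their common face, which therefore has a vertex
    -- higher than `x`. That vertex links the higher vertices of both faces.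
    classical
    have hi : (a : EuclideanSpace ℝ (Fin d)) ∈
        convexHull ℝ ((s ∩ s' : Finset _) : Set (EuclideanSpace ℝ (Fin d))) := by
      rw [Finset.coe_inter]
      exact M.complex.inter_subset_convexHull hs hs' ⟨has, has'⟩
    have hne : (s ∩ s').Nonempty := by
      rw [← Finset.coe_nonempty, ← convexHull_nonempty_iff (𝕜 := ℝ)]
      exact ⟨_, hi⟩
    obtain ⟨e, he, hlte⟩ :=
      hup _ (M.complex.down_closed hs Finset.inter_subset_left hne) a hi
    rw [Finset.mem_inter] at he
    exact hb' ((hb.trans (M.reachableIn_of_mem_face hs hbs he.1 hlt hlte)).trans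
      (M.reachableIn_of_mem_face hs' he.2 hbs' hlte hlt'))
  have hcompl : (A R)ᶜ = A (fun b => ¬ R b) := IsCompl.compl_eq ⟨hdisj, codisjoint_iff.2 hcover⟩
  have hclopen : IsClopen (A R) := ⟨hA _, by rw [← isClosed_compl_iff, hcompl]; exact hA _⟩
  let p' : L := ⟨p, ⟨Or.inl (M.complex.convexHull_subset_space hxy hp), hpb⟩, hph⟩
  let q' : L := ⟨q, ⟨Or.inl (M.complex.convexHull_subset_space hxz hq), hqb⟩, hqh⟩
  have hp' : p' ∈ A R := memA hxy (by simp) hlty (.refl hlty) hp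
  have huniv := hclopen.eq_univ ⟨p', hp'⟩
  by_contra hRz
  have hq' : q' ∈ A (fun b => ¬ R b) := memA hxz (by simp) hltz hRz hq
  exact Set.disjoint_left.1 hdisj (huniv ▸ Set.mem_univ q') hq'

/-- The two edges may start at different points of one boundary facet. Boundary criticality excludes
this: either the start is a local minimum, with down-degree `0` and hence not regular, or the facet
has no higher neighbour. So both edges start at one regular point, whose local upper contour is
connected. -/
theorem reachableIn_of_not_isCritical {v y z : M.Vertex} (hv : ¬ M.IsCritical v)
    (hy : M.skeleton.Adj v y) (hz : M.skeleton.Adj v z)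
    (hlty : M.vertexHeight v < M.vertexHeight y) (hltz : M.vertexHeight v < M.vertexHeight z) :
    M.skeleton.ReachableIn (M.higher (M.vertexHeight v)) y z := by
  obtain ⟨x, y, hx, rfl, hxy⟩ := M.exists_pair_of_adj hy
  obtain ⟨x', z, hx', rfl, hxz⟩ := M.exists_pair_of_adj hz
  have hreg : M.IsRegularPoint x := by
    by_contra h
    exact hv ⟨x, hx, h⟩
  have hxx' : x = x' := by
    by_contra hne
    obtain ⟨F, hF, hxF, hxF'⟩ := (Quotient.exact (hx.trans hx'.symm)).resolve_left hne
    subst hx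
    have hyF : ↑y ∉ F := fun h => hlty.ne (M.height_boundary F hF _ hxF _ h)
    rcases M.boundary_critical F hF with h | h
    · refine hreg.not_hasMorseDownDegree_zero (M.hasMorseDownDegree_zero x.2 fun b hb => ?_)
      by_cases hbF : b ∈ F
      · exact (M.height_boundary F hF _ hxF _ hbF).le
      · exact (h _ hxF _ hbF x.2 hb).le
    · exact (h _ hxF _ hyF x.2 hxy).asymm hlty
  subst hxx' hx
  exact hreg.1.reachableIn hxy hxz hlty hltz

/-! ### Superlevel components -/

/-- The vertices of the 1-skeleton of height at least `t`. -/
abbrev atLeast (t : ℝ) : Set M.Vertex := {u | t ≤ M.vertexHeight u}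

theorem atLeast_anti {s t : ℝ} (h : s ≤ t) : M.atLeast t ⊆ M.atLeast s := fun _ hu => h.trans hu

theorem atLeast_subset_higher {s t : ℝ} (h : s < t) : M.atLeast t ⊆ M.higher s :=
  fun _ hu => h.trans_le hu

theorem higher_subset_atLeast {s t : ℝ} (h : s ≤ t) : M.higher t ⊆ M.atLeast s :=
  fun _ hu => h.trans (le_of_lt hu)

variable {M}

/-- Walks reach `v` only from the components of `M⁺_v` adjacent to it. -/
theorem reachableIn_higher_or_exists_adj {v a x : M.Vertex}
    (ha : M.vertexHeight v < M.vertexHeight a)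
    (h : M.skeleton.ReachableIn (M.atLeast (M.vertexHeight v)) a x) :
    M.skeleton.ReachableIn (M.higher (M.vertexHeight v)) a x ∨
      ∃ y, M.skeleton.Adj v y ∧ M.skeleton.ReachableIn (M.higher (M.vertexHeight v)) a y := by
  refine h.induction (P := fun x => M.skeleton.ReachableIn (M.higher (M.vertexHeight v)) a x ∨
    ∃ y, M.skeleton.Adj v y ∧ M.skeleton.ReachableIn (M.higher (M.vertexHeight v)) a y)
    (Or.inl (.refl ha)) fun b c _ hc hbc ih => ih.elim (fun hb => ?_) Or.inr
  rcases (show M.vertexHeight v ≤ M.vertexHeight c from hc).eq_or_lt with heq | hlt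
  · cases M.vertexHeight_injective heq
    exact Or.inr ⟨b, hbc.symm, hb⟩
  · exact Or.inl (hb.trans (hbc.reachableIn hb.2.1 hlt))

theorem reachableIn_atLeast_of_adj {v y a : M.Vertex} (hy : M.skeleton.Adj v y)
    (h : M.skeleton.ReachableIn (M.higher (M.vertexHeight v)) y a) :
    M.skeleton.ReachableIn (M.atLeast (M.vertexHeight v)) v a :=
  (hy.reachableIn (le_refl (M.vertexHeight v)) (M.higher_subset_atLeast le_rfl h.1)).trans
    (h.mono (M.higher_subset_atLeast le_rfl))

theorem exists_adj_of_reachableIn_atLeast {v a : M.Vertex}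
    (ha : M.vertexHeight v < M.vertexHeight a)
    (h : M.skeleton.ReachableIn (M.atLeast (M.vertexHeight v)) v a) :
    ∃ y, M.skeleton.Adj v y ∧ M.skeleton.ReachableIn (M.higher (M.vertexHeight v)) y a := by
  rcases reachableIn_higher_or_exists_adj ha h.symm with h | ⟨y, hy, h⟩
  · exact absurd h.2.1 (lt_irrefl (M.vertexHeight v))
  · exact ⟨y, hy, h.symm⟩

theorem exists_reachableIn_atLeast {t : ℝ} {x y : M.Vertex}
    (h : M.skeleton.ReachableIn (M.higher t) x y) :
    ∃ z, t < M.vertexHeight z ∧ M.skeleton.ReachableIn (M.atLeast (M.vertexHeight z)) x y := by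
  obtain ⟨z, hz, hmin⟩ :=
    Set.exists_min_image (M.higher t) M.vertexHeight (Set.toFinite _) ⟨x, h.1⟩
  exact ⟨z, hz, h.mono hmin⟩

/-- Two connected vertices are either connected at the height of one of them, or their
superlevel components merge at a critical point. -/
theorem exists_merge {t : ℝ} {x y : M.Vertex} (h : M.skeleton.ReachableIn (M.higher t) x y) :
    ∃ z, t < M.vertexHeight z ∧ M.skeleton.ReachableIn (M.atLeast (M.vertexHeight z)) x y ∧
      (z = x ∨ z = y ∨ (M.vertexHeight z < M.vertexHeight x ∧ M.IsCritical z ∧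
        M.skeleton.ReachableIn (M.atLeast (M.vertexHeight z)) z x)) := by
  -- `z` marks the highest threshold at which `x` and `y` are still connected.
  obtain ⟨z, ⟨htz, hz⟩, hmax⟩ := Set.exists_max_image
    {z | t < M.vertexHeight z ∧ M.skeleton.ReachableIn (M.atLeast (M.vertexHeight z)) x y}
    M.vertexHeight (Set.toFinite _) (exists_reachableIn_atLeast h)
  refine ⟨z, htz, hz, ?_⟩
  have hnot : ¬ M.skeleton.ReachableIn (M.higher (M.vertexHeight z)) x y := by
    intro h'
    obtain ⟨w, hw, hw'⟩ := exists_reachableIn_atLeast h'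
    exact (hmax w ⟨htz.trans hw, hw'⟩).not_gt hw
  rcases (show M.vertexHeight z ≤ _ from hz.1).eq_or_lt with hx | hx
  · exact Or.inl (M.vertexHeight_injective hx)
  rcases (show M.vertexHeight z ≤ _ from hz.2.1).eq_or_lt with hy | hy
  · exact Or.inr (Or.inl (M.vertexHeight_injective hy))
  obtain ⟨a, hza, hxa⟩ := (reachableIn_higher_or_exists_adj hx hz).resolve_left hnot
  obtain ⟨b, hzb, hyb⟩ :=
    (reachableIn_higher_or_exists_adj hy hz.symm).resolve_left fun h' => hnot h'.symm
  refine Or.inr (Or.inr ⟨hx, ?_, reachableIn_atLeast_of_adj hza hxa.symm⟩)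
  -- Both components above `z` are adjacent to `z`; were `z` not critical, they would coincide and
  -- connect `x` to `y` strictly above `z`.
  by_contra hcrit
  exact hnot ((hxa.trans (M.reachableIn_of_not_isCritical hcrit hza hzb hxa.2.1 hyb.2.1)).trans
    hyb.symm)

/-- Every superlevel component contains a maximum. -/
theorem exists_isMaximum_reachableIn (v : M.Vertex) :
    ∃ x, M.IsMaximum x ∧ M.skeleton.ReachableIn (M.atLeast (M.vertexHeight v)) v x := by
  obtain ⟨x, hx, hmax⟩ := Set.exists_max_image
    {x | M.skeleton.ReachableIn (M.atLeast (M.vertexHeight v)) v x} M.vertexHeight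
    (Set.toFinite _) ⟨v, .refl (show M.vertexHeight v ≤ _ from le_rfl)⟩
  refine ⟨x, M.isMaximum_iff.2 fun u hu => ?_, hx⟩
  by_contra hlt
  rcases (not_lt.1 hlt).eq_or_lt with heq | hlt
  · exact hu.1 (M.vertexHeight_injective heq)
  · have hxv : M.vertexHeight v ≤ M.vertexHeight x := hx.2.1
    exact (hmax u (hx.trans (hu.reachableIn hx.2.1 (hxv.trans hlt.le)))).not_gt hlt

variable (M)

theorem reachableIn_iff_mem_supp {v : M.Vertex} {C : (M.above v).ConnectedComponent}
    {y : {u : M.Vertex // M.vertexHeight v < M.vertexHeight u}} (hy : y ∈ C.supp)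
    {z : M.Vertex} (hz : M.vertexHeight v < M.vertexHeight z) :
    M.skeleton.ReachableIn (M.higher (M.vertexHeight v)) y z ↔ ⟨z, hz⟩ ∈ C.supp := by
  rw [ConnectedComponent.mem_supp_iff] at hy ⊢
  subst hy
  rw [ConnectedComponent.eq]
  exact ⟨fun ⟨_, _, h⟩ => h.symm, fun h => ⟨y.2, hz, h.symm⟩⟩

/-- The up-star of `v` containing the edges to the component of `y` in `M⁺_v`. -/
def upStar (v y : M.Vertex) : Set M.Edge :=
  {e | e.lower = v ∧ M.skeleton.ReachableIn (M.higher (M.vertexHeight v)) y e.upper}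

/-- Replaces components of `M⁺_v` by a representative neighbour `y`, so that later arguments can use
`ReachableIn` with varying thresholds in place of subtypes. -/
theorem isUpStar_iff {v : M.Vertex} {U : Set M.Edge} :
    M.IsUpStar v U ↔ ∃ y, M.skeleton.Adj v y ∧ M.vertexHeight v < M.vertexHeight y ∧
      U = M.upStar v y := by
  have key : ∀ (C : (M.above v).ConnectedComponent)
      (y : {u : M.Vertex // M.vertexHeight v < M.vertexHeight u}), y ∈ C.supp →
      {e : M.Edge | e.lower = v ∧ ∃ y ∈ C.supp, e.upper = y.1} = M.upStar v y := by
    intro C y hy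
    ext e
    refine and_congr_right fun he => ⟨?_, fun h => ⟨⟨e.upper, h.2.1⟩, ?_, rfl⟩⟩
    · rintro ⟨z, hz, h⟩
      rw [h]
      exact (M.reachableIn_iff_mem_supp hy z.2).2 hz
    · exact (M.reachableIn_iff_mem_supp hy h.2.1).1 h
  constructor
  · rintro ⟨⟨e, he⟩, C, rfl⟩
    obtain ⟨rfl, y, hy, hey⟩ := he
    exact ⟨e.upper, e.adj.symm, e.lt, hey ▸ key C y hy⟩
  · rintro ⟨y, hvy, hlt, rfl⟩
    refine ⟨⟨⟨y, v, hvy.symm, hlt⟩, rfl, .refl hlt⟩, (M.above v).connectedComponentMk ⟨y, hlt⟩, ?_⟩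
    exact (key _ ⟨y, hlt⟩ rfl).symm

theorem joinTree_adj_iff {u v : M.CriticalPoint} :
    M.joinTree.Adj u v ↔ ∃ y, M.skeleton.Adj v.1 y ∧
      M.skeleton.ReachableIn (M.higher (M.vertexHeight v.1)) y u.1 ∧
      ∀ w, M.IsCritical w → M.skeleton.ReachableIn (M.higher (M.vertexHeight v.1)) y w →
        M.vertexHeight u.1 ≤ M.vertexHeight w := by
  constructor
  · rintro ⟨C, ⟨hu, huC⟩, hmin, y, hyC, hvy⟩
    exact ⟨y, hvy, (M.reachableIn_iff_mem_supp hyC hu).2 huC, fun w hw h =>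
      hmin ⟨w, hw⟩ h.2.1 ((M.reachableIn_iff_mem_supp hyC h.2.1).1 h)⟩
  · rintro ⟨y, hvy, hu, hmin⟩
    refine ⟨(M.above v.1).connectedComponentMk ⟨y, hu.1⟩, ⟨hu.2.1, ?_⟩, fun w hw hwC => ?_,
      ⟨y, hu.1⟩, rfl, hvy⟩
    · exact (M.reachableIn_iff_mem_supp (y := ⟨y, hu.1⟩) rfl hu.2.1).1 hu
    · exact hmin w.1 w.2 ((M.reachableIn_iff_mem_supp (y := ⟨y, hu.1⟩) rfl hw).2 hwC)

/-! ### Paintings -/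

instance : Finite M.Edge :=
  Finite.of_injective (fun e : M.Edge => (e.upper, e.lower)) fun _ _ h =>
    Edge.ext (congrArg Prod.fst h) (congrArg Prod.snd h)

variable {M}

namespace InitialPainting

variable (χ : M.InitialPainting)

/-- The maximum of a given color. -/
noncomputable def top (c : M.Color) : M.Maximum := (χ.bijective.surjective c).choose

@[simp]
theorem maxColor_top (c : M.Color) : χ.maxColor (χ.top c) = c :=
  (χ.bijective.surjective c).choose_spec

@[simp]
theorem top_maxColor (x : M.Maximum) : χ.top (χ.maxColor x) = x :=
  χ.bijective.injective (χ.maxColor_top _)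

/-- The path from the maximum to the edge is descending, so it never goes below its end `e.upper`.
This is the only use made of the path condition of a painting. -/
theorem reachableIn_top (e : M.Edge) :
    M.skeleton.ReachableIn (M.atLeast (M.vertexHeight e.upper)) (χ.top (χ.edgeColor e)).1
      e.upper := by
  obtain ⟨x, hx, hpath⟩ := χ.exists_path e
  rw [hx, top_maxColor]
  generalize x.1 = v at hpath
  induction hpath using Relation.ReflTransGen.head_induction_on with
  | refl => exact .refl (show M.vertexHeight e.upper ≤ _ from le_rfl)
  | head hab _ ih =>
    obtain ⟨a, rfl, rfl, -⟩ := hab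
    have h : M.vertexHeight e.upper ≤ M.vertexHeight a.lower := ih.1
    exact (a.adj.reachableIn (h.trans a.lt.le) h).trans ih

end InitialPainting

/-! ### The painting phase -/

namespace PaintState

/-- `v` is reached from a maximum by a descending path in the color `c`. -/
def Reached (s : M.PaintState) (v : M.Vertex) (c : M.Color) : Prop :=
  ∃ x : M.Maximum, s.maxColor x = some c ∧ Relation.ReflTransGen
    (fun u v => ∃ a : M.Edge, a.upper = u ∧ a.lower = v ∧ s.edgeColor a = some c) x.1 v

/-- `v` has been explored, or will be. -/
def Found (s : M.PaintState) (v : M.Vertex) : Prop :=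
  (∀ e : M.Edge, e.upper = v → s.edgeColor e ≠ none) ∨ ∃ c, (v, c) ∈ s.queue

/-- The invariant of the painting phase. -/
structure Valid (s : M.PaintState) : Prop where
  injective : ∀ x y c, s.maxColor x = some c → s.maxColor y = some c → x = y
  edge : ∀ e c, s.edgeColor e = some c → s.Reached e.upper c
  queue : ∀ v c, (v, c) ∈ s.queue → s.Reached v c
  found_max : ∀ x : M.Maximum, s.maxColor x ≠ none → s.Found x.1
  found_lower : ∀ e : M.Edge, s.edgeColor e ≠ none → s.Found e.lower

/-- A quantity decreasing during the painting phase. -/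
noncomputable def potential (s : M.PaintState) : ℕ :=
  2 * {x | s.maxColor x = none}.ncard + 2 * {e | s.edgeColor e = none}.ncard + s.queue.length

theorem Reached.mono {s t : M.PaintState}
    (hm : ∀ x c, s.maxColor x = some c → t.maxColor x = some c)
    (he : ∀ e c, s.edgeColor e = some c → t.edgeColor e = some c) {v : M.Vertex} {c : M.Color}
    (h : s.Reached v c) : t.Reached v c := by
  obtain ⟨x, hx, hp⟩ := h
  exact ⟨x, hm x c hx, Relation.ReflTransGen.mono
    (fun _ _ ⟨a, hu, hl, hc⟩ => ⟨a, hu, hl, he a c hc⟩) _ _ hp⟩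

end PaintState

open PaintState

theorem PaintStep.valid {s t : M.PaintState} (h : M.PaintStep s t) (hs : s.Valid) : t.Valid := by
  classical
  cases h with
  | pour x c hq hx hc =>
    have hm : ∀ y b, s.maxColor y = some b →
        Function.update s.maxColor x (some c) y = some b := by
      intro y b hy
      rw [Function.update_of_ne, hy]
      rintro rfl
      rw [hx] at hy
      cases hy
    set t : M.PaintState :=
      { s with maxColor := Function.update s.maxColor x (some c), queue := [(x.1, c)] } with ht
    have htm : ∀ y, t.maxColor y = Function.update s.maxColor x (some c) y := fun _ => rfl
    have htq : t.queue = [(x.1, c)] := rfl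
    have hr : ∀ {v b}, s.Reached v b → t.Reached v b :=
      fun h => h.mono (s := s) (t := t) hm fun _ _ h => h
    -- A new search starts only with an empty queue, so a vertex found earlier has already been
    -- explored and overwriting the queue loses nothing.
    have hf : ∀ v, s.Found v → t.Found v := by
      rintro v (h | ⟨b, hb⟩)
      · exact Or.inl h
      · simp [hq] at hb
    refine ⟨?_, fun e b he => hr (hs.edge e b he), ?_, ?_, fun e he => hf _ (hs.found_lower e he)⟩
    · intro y z b hy hz
      rw [htm, Function.update_apply] at hy hz
      split_ifs at hy hz with h1 h2 h2
      · rw [h1, h2]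
      · cases hy
        exact absurd hz (hc z)
      · cases hz
        exact absurd hy (hc y)
      · exact hs.injective y z b hy hz
    · intro v b hb
      obtain ⟨rfl, rfl⟩ : v = x.1 ∧ b = c := by simpa [htq] using hb
      exact ⟨x, Function.update_self .., .refl⟩
    · intro y hy
      by_cases hyx : y = x
      · subst hyx
        exact Or.inr ⟨c, by simp [htq]⟩
      · exact hf _ (hs.found_max y (by simpa [htm, Function.update_of_ne hyx] using hy))
  | spread v c q es hq hnd hes =>
    have he : ∀ e b, s.edgeColor e = some b →
        (if e ∈ es then some c else s.edgeColor e) = some b := by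
      intro e b heb
      rw [if_neg, heb]
      intro h
      rw [((hes e).1 h).2] at heb
      cases heb
    set t : M.PaintState := { s with
        edgeColor := fun e => if e ∈ es then some c else s.edgeColor e
        queue := q ++ es.map fun e => (e.lower, c) } with ht
    have hr : ∀ {v b}, s.Reached v b → t.Reached v b :=
      fun h => h.mono (s := s) (t := t) (fun _ _ h => h) he
    have hv : t.Reached v c := hr (hs.queue v c (by simp [hq]))
    have hmem : ∀ e, e ∈ es → t.edgeColor e = some c := fun e h => if_pos h
    have hne : ∀ e, s.edgeColor e ≠ none → t.edgeColor e ≠ none := by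
      intro e h
      obtain ⟨b, hb⟩ := Option.ne_none_iff_exists'.1 h
      rw [show t.edgeColor e = some b from he e b hb]
      exact Option.some_ne_none b
    -- The explored vertex leaves the queue, but now all its downward edges are colored.
    have hf : ∀ w, s.Found w → t.Found w := by
      rintro w (h | ⟨b, hb⟩)
      · exact Or.inl fun e hew => hne e (h e hew)
      · rw [hq, List.mem_cons] at hb
        rcases hb with hb | hb
        · cases hb
          refine Or.inl fun e hew => ?_
          by_cases hnone : s.edgeColor e = none
          · rw [hmem e ((hes e).2 ⟨hew, hnone⟩)]
            exact Option.some_ne_none c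
          · exact hne e hnone
        · exact Or.inr ⟨b, List.mem_append_left _ hb⟩
    refine ⟨hs.injective, ?_, ?_, fun x hx => hf _ (hs.found_max x hx), ?_⟩
    · intro e b heb
      by_cases hmem' : e ∈ es
      · rw [hmem e hmem'] at heb
        cases heb
        rw [((hes e).1 hmem').1]
        exact hv
      · exact hr (hs.edge e b ((if_neg hmem').symm.trans heb))
    · intro w b hb
      rcases List.mem_append.1 hb with hb | hb
      · exact hr (hs.queue w b (by simp [hq, hb]))
      · obtain ⟨e, hee, heq⟩ := List.mem_map.1 hb
        cases heq
        obtain ⟨x, hx, hp⟩ := hv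
        exact ⟨x, hx, hp.tail ⟨e, ((hes e).1 hee).1, rfl, hmem e hee⟩⟩
    · intro e hee
      by_cases hmem' : e ∈ es
      · exact Or.inr ⟨c, List.mem_append_right _ (List.mem_map.2 ⟨e, hmem', rfl⟩)⟩
      · exact hf _ (hs.found_lower e fun h => hee ((if_neg hmem').trans h))

/-- Each newly colored maximum or edge adds one queue entry and removes two units of potential;
exploring a vertex also removes its queue entry, so even a step without new edges counts. -/
theorem PaintStep.potential_lt {s t : M.PaintState} (h : M.PaintStep s t) :
    t.potential < s.potential := by
  classical
  cases h with
  | pour x c hq hx hc =>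
    have h1 : {y | Function.update s.maxColor x (some c) y = none} =
        {y | s.maxColor y = none} \ {x} := by
      ext y
      by_cases hyx : y = x <;> simp [hyx, Function.update_apply]
    have h2 := Set.ncard_sdiff_singleton_add_one (s := {y | s.maxColor y = none}) hx
    simp only [potential, h1, hq, List.length_nil, List.length_singleton]
    omega
  | spread v c q es hq hnd hes =>
    have h1 : {e | (if e ∈ es then some c else s.edgeColor e) = none} =
        {e | s.edgeColor e = none} \ {e | e ∈ es} := by
      ext e
      by_cases hee : e ∈ es <;> simp [hee]
    have h2 : {e | e ∈ es}.ncard = es.length := by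
      rw [← List.toFinset_card_of_nodup hnd, ← Set.ncard_coe_finset]
      simp
    have h3 := Set.ncard_sdiff_add_ncard_of_subset (s := {e | e ∈ es})
      (t := {e | s.edgeColor e = none}) fun e hee => ((hes e).1 hee).2
    simp only [potential, h1, hq, List.length_append, List.length_map, List.length_cons]
    omega

/-- Consider an uncolored edge with highest upper endpoint. This endpoint is a colored maximum or
the lower end of a colored edge; either way it was found, hence explored. -/
theorem PaintState.Valid.edgeColor_ne_none {s : M.PaintState} (hs : s.Valid) (hq : s.queue = [])
    (hm : ∀ x, s.maxColor x ≠ none) (e : M.Edge) : s.edgeColor e ≠ none := by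
  have hfound : ∀ {v}, s.Found v → ∀ e : M.Edge, e.upper = v → s.edgeColor e ≠ none := by
    rintro v (h | ⟨c, hc⟩)
    · exact h
    · simp [hq] at hc
  by_contra hnone
  obtain ⟨e, he, hmax⟩ := Set.exists_max_image {e | s.edgeColor e = none}
    (fun e => M.vertexHeight e.upper) (Set.toFinite _) ⟨e, hnone⟩
  by_cases hx : M.IsMaximum e.upper
  · exact hfound (hs.found_max ⟨_, hx⟩ (hm _)) e rfl he
  · rw [isMaximum_iff] at hx
    push Not at hx
    obtain ⟨u, hadj, hle⟩ := hx
    have hlt := hle.lt_of_ne fun h => hadj.1 (M.vertexHeight_injective h)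
    let e' : M.Edge := ⟨u, e.upper, hadj.symm, hlt⟩
    have he' : s.edgeColor e' ≠ none := fun h => (hmax e' h).not_gt hlt
    exact hfound (hs.found_lower e' he') e rfl he

/-- The painting phase does not get stuck. -/
theorem PaintState.Valid.exists_step {s : M.PaintState} (hs : s.Valid) :
    (∃ t, M.PaintStep s t) ∨ s.queue = [] ∧ ∃ χ : M.InitialPainting,
      (∀ x, s.maxColor x = some (χ.maxColor x)) ∧ ∀ e, s.edgeColor e = some (χ.edgeColor e) := by
  classical
  rcases hq : s.queue with _ | ⟨⟨v, c⟩, q⟩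
  · by_cases hm : ∀ x, s.maxColor x ≠ none
    · right
      refine ⟨rfl, ?_⟩
      choose mc hmc using fun x => Option.ne_none_iff_exists'.1 (hm x)
      choose ec hec using fun e => Option.ne_none_iff_exists'.1 (hs.edgeColor_ne_none hq hm e)
      have hinj : Function.Injective mc :=
        fun x y h => hs.injective x y (mc x) (hmc x) (h ▸ hmc y)
      refine ⟨⟨⟨mc, ec, fun e => ?_⟩, hinj.bijective_of_nat_card_le (by simp)⟩, hmc, hec⟩
      obtain ⟨x, hx, hp⟩ := hs.edge e _ (hec e)
      have hcx : ec e = mc x := Option.some.inj (hx.symm.trans (hmc x))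
      refine ⟨x, hcx, Relation.ReflTransGen.mono ?_ _ _ hp⟩
      rintro _ _ ⟨a, rfl, rfl, ha⟩
      exact ⟨a, rfl, rfl, (Option.some.inj ((hec a).symm.trans ha)).trans hcx⟩
    · left
      push Not at hm
      obtain ⟨x, hx⟩ := hm
      -- There are as many colors as maxima: if all colors were in use, every maximum, also `x`,
      -- would be colored.
      obtain ⟨c, hc⟩ : ∃ c, ∀ y, s.maxColor y ≠ some c := by
        by_contra! H
        choose g hg using H
        have hinj : Function.Injective g :=
          fun a b h => Option.some.inj ((hg a).symm.trans (h ▸ hg b))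
        obtain ⟨c, rfl⟩ := (hinj.bijective_of_nat_card_le (by simp)).surjective x
        rw [hg c] at hx
        cases hx
      exact ⟨_, .pour s x c hq hx hc⟩
  · left
    have hfin : {e : M.Edge | e.upper = v ∧ s.edgeColor e = none}.Finite := Set.toFinite _
    exact ⟨_, .spread s v c q hfin.toFinset.toList hq (Finset.nodup_toList _) (by simp)⟩

variable (M)

/-! ### The invariant of the main loop -/

/-- `x` lies in the component of `v` in the complex induced on the vertices not lower than `v`. -/
def Over (v x : M.Vertex) : Prop :=
  M.skeleton.ReachableIn (M.atLeast (M.vertexHeight v)) v x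

/-- `x` lies in the component of `y` in `M⁺_v`. -/
def Beyond (v y x : M.Vertex) : Prop :=
  M.skeleton.ReachableIn (M.higher (M.vertexHeight v)) y x

variable {M}

theorem Over.refl (v : M.Vertex) : M.Over v v :=
  ReachableIn.refl (le_refl (M.vertexHeight v))

theorem Over.le {v x : M.Vertex} (h : M.Over v x) : M.vertexHeight v ≤ M.vertexHeight x := h.2.1

theorem Over.trans {v x y : M.Vertex} (h : M.Over v x) (h' : M.Over x y) : M.Over v y :=
  ReachableIn.trans h (h'.mono (M.atLeast_anti h.le))

theorem Over.beyond {v a x : M.Vertex} (h : M.Over a x)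
    (hlt : M.vertexHeight v < M.vertexHeight a) : M.Beyond v a x :=
  h.mono (M.atLeast_subset_higher hlt)

theorem Beyond.lt {v y x : M.Vertex} (h : M.Beyond v y x) :
    M.vertexHeight v < M.vertexHeight x := h.2.1

theorem Beyond.over {v y x : M.Vertex} (hy : M.skeleton.Adj v y) (h : M.Beyond v y x) :
    M.Over v x := reachableIn_atLeast_of_adj hy h

theorem Over.exists_beyond {v x : M.Vertex} (h : M.Over v x) (hne : v ≠ x) :
    ∃ y, M.skeleton.Adj v y ∧ M.Beyond v y x :=
  exists_adj_of_reachableIn_atLeast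
    (h.le.lt_of_ne fun heq => hne (M.vertexHeight_injective heq)) h

theorem IsMaximum.eq_of_over {v x : M.Vertex} (hv : M.IsMaximum v) (h : M.Over v x) : v = x := by
  by_contra hne
  obtain ⟨y, hy, hb⟩ := h.exists_beyond hne
  exact (M.isMaximum_iff.1 hv y hy).asymm (show M.vertexHeight v < _ from hb.1)

theorem InitialPainting.beyond_top (χ : M.InitialPainting) (e : M.Edge) :
    M.Beyond e.lower e.upper (χ.top (χ.edgeColor e)).1 :=
  (χ.reachableIn_top e).symm.mono (M.atLeast_subset_higher e.lt)

theorem IsMaximum.not_isUpStar {v : M.Vertex} (hv : M.IsMaximum v) (U : Set M.Edge) :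
    ¬ M.IsUpStar v U := by
  rw [isUpStar_iff]
  rintro ⟨y, hy, hlt, -⟩
  exact (M.isMaximum_iff.1 hv y hy).asymm hlt

theorem IsMaximum.not_joinTree_adj {u v : M.CriticalPoint} (hv : M.IsMaximum v.1) :
    ¬ M.joinTree.Adj u v := by
  rw [joinTree_adj_iff]
  rintro ⟨y, hy, hb, -⟩
  exact (M.isMaximum_iff.1 hv y hy).asymm (show M.vertexHeight v.1 < _ from hb.1)

/-- A component of `M⁺_v` has a lowest critical point, and its maxima lie over this point. -/
theorem exists_lowest {v y : M.Vertex} (hlt : M.vertexHeight v < M.vertexHeight y) :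
    ∃ u : M.CriticalPoint, M.Beyond v y u.1 ∧
      (∀ w, M.IsCritical w → M.Beyond v y w → M.vertexHeight u.1 ≤ M.vertexHeight w) ∧
      ∀ x, M.IsMaximum x → M.Beyond v y x → M.Over u.1 x := by
  obtain ⟨x, hx, hyx⟩ := exists_isMaximum_reachableIn y
  obtain ⟨u, ⟨hu, hyu⟩, hmin⟩ := Set.exists_min_image
    {u | M.IsCritical u ∧ M.Beyond v y u} M.vertexHeight (Set.toFinite _)
    ⟨x, hx.isCritical, Over.beyond hyx hlt⟩
  refine ⟨⟨u, hu⟩, hyu, fun w hw hb => hmin w ⟨hw, hb⟩, fun x hx hyx => ?_⟩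
  obtain ⟨z, hvz, hz, h⟩ := exists_merge (ReachableIn.trans hyu.symm hyx)
  have hux := hmin x ⟨hx.isCritical, hyx⟩
  rcases h with rfl | rfl | ⟨hzu, hcrit, hzx⟩
  · exact hz
  · exact ReachableIn.mono hz (M.atLeast_anti hux)
  -- A merge strictly below `u` would occur at a critical point of the same component, against the
  -- minimality of `u`.
  · have hyz : M.Beyond v y z :=
      ReachableIn.trans hyu (hzx.symm.mono (M.atLeast_subset_higher hvz))
    exact absurd hzu (hmin z ⟨hcrit, hyz⟩).not_gt

/-- The invariant of the main loop: the processed points form an upper set of the join tree,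
each class of colors consists of the maxima over the point it is attached to, the heap of a class
contains the unprocessed points inserted into the heaps of its colors, and the output is the
restriction of the join tree to the processed points. -/
structure Sound (χ : M.InitialPainting) (s : M.BuildState) : Prop where
  rep_rep : ∀ c, s.rep (s.rep c) = s.rep c
  mem_of_isMaximum : ∀ v : M.CriticalPoint, M.IsMaximum v.1 → v ∈ s.processed
  mem_of_over : ∀ v w : M.CriticalPoint, v ∈ s.processed → M.Over v.1 w.1 → w ∈ s.processed
  att_mem : ∀ c, s.att (s.rep c) ∈ s.processed
  over_top : ∀ c, M.Over (s.att (s.rep c)).1 (χ.top c).1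
  rep_eq : ∀ c c', M.Over (s.att (s.rep c)).1 (χ.top c').1 → s.rep c' = s.rep c
  exists_over : ∀ v ∈ s.processed, ∃ c, M.Over (s.att (s.rep c)).1 v.1
  exists_pick : ∃ pick : M.CriticalPoint → Set M.Edge → M.Color,
    (∀ v U, M.IsUpStar v.1 U → pick v U ∈ χ.edgeColor '' U) ∧
    ∀ c v, v ∈ s.heap (s.rep c) ↔
      v ∉ s.processed ∧ ∃ U, M.IsUpStar v.1 U ∧ s.rep (pick v U) = s.rep c
  output_adj : ∀ u v, s.output.Adj u v ↔ v ∈ s.processed ∧ M.joinTree.Adj u v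

theorem IsInitialized.sound {χ : M.InitialPainting} {s : M.BuildState}
    (hs : IsInitialized χ s) : Sound χ s := by
  obtain ⟨⟨pick, hpick, hheap⟩, hrep, hatt, -, hproc, hout⟩ := hs
  have hatt' : ∀ c, s.att c = (χ.top c).toCritical := fun c => by
    rw [← hatt, χ.maxColor_top]
  have hmem : ∀ v, v ∈ s.processed ↔ M.IsMaximum v.1 := fun v => by rw [hproc]; rfl
  refine ⟨fun c => by rw [hrep], fun v hv => (hmem v).2 hv, ?_, ?_, ?_, ?_, ?_,
    ⟨pick, hpick, ?_⟩, ?_⟩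
  · intro v w hv h
    rw [hmem] at hv ⊢
    exact hv.eq_of_over h ▸ hv
  · intro c
    rw [hmem, hatt']
    exact (χ.top _).2
  · intro c
    rw [hatt', hrep]
    exact Over.refl _
  · intro c c' h
    rw [hatt', hrep] at h
    have : χ.top c = χ.top c' := Subtype.ext ((χ.top c).2.eq_of_over h)
    rw [← χ.maxColor_top c, this, χ.maxColor_top]
  · intro v hv
    rw [hmem] at hv
    refine ⟨χ.maxColor ⟨v.1, hv⟩, ?_⟩
    rw [hrep, hatt]
    exact Over.refl _
  · intro c v
    rw [hrep, hheap, hmem]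
    simp only [hrep]
    exact ⟨fun ⟨U, hU, h⟩ => ⟨fun hv => hv.not_isUpStar U hU, U, hU, h⟩, fun h => h.2⟩
  · intro u v
    rw [hout, hmem]
    exact ⟨False.elim, fun h => h.1.not_joinTree_adj h.2⟩

/-! ### Consequences of the invariant, and its preservation by processing -/

namespace Sound

variable {χ : M.InitialPainting} {s : M.BuildState}

theorem with_stack (hs : Sound χ s) (K : List M.CriticalPoint) :
    Sound χ { s with stack := K } :=
  ⟨hs.rep_rep, hs.mem_of_isMaximum, hs.mem_of_over, hs.att_mem, hs.over_top, hs.rep_eq,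
    hs.exists_over, hs.exists_pick, hs.output_adj⟩

theorem exists_edge (hs : Sound χ s) {h : M.CriticalPoint} (hh : h ∉ s.processed) {c : M.Color}
    (hc : c ∈ χ.col h.1) : ∃ e : M.Edge, e.lower = h.1 ∧ χ.edgeColor e = c := by
  rcases hc with hc | ⟨x, hx, -⟩
  · exact hc
  · exact absurd (hs.mem_of_isMaximum h (hx ▸ x.2)) hh

/-- If all critical points in a component of `M⁺_v` are processed, the colors of its maxima are
attached to a point under its lowest critical point. -/
theorem over_lowest (hs : Sound χ s) {v y : M.Vertex}
    (hall : ∀ w : M.CriticalPoint, M.Beyond v y w.1 → w ∈ s.processed) {u : M.CriticalPoint}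
    (hu : M.Beyond v y u.1) (hmax : ∀ x, M.IsMaximum x → M.Beyond v y x → M.Over u.1 x)
    {c : M.Color} (hc : M.Beyond v y (χ.top c).1) : M.Over (s.att (s.rep c)).1 u.1 := by
  obtain ⟨c₀, h₀⟩ := hs.exists_over u (hall u hu)
  rwa [hs.rep_eq c₀ c (h₀.trans (hmax _ (χ.top c).2 hc))]

/-- All maxima of the component lie over its lowest critical point, which in turn lies over the
attached point of the class of `c`; so that class contains `c'`. -/
theorem rep_eq_of_beyond (hs : Sound χ s) {v y : M.Vertex}
    (hall : ∀ w : M.CriticalPoint, M.Beyond v y w.1 → w ∈ s.processed) {c c' : M.Color}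
    (hc : M.Beyond v y (χ.top c).1) (hc' : M.Beyond v y (χ.top c').1) : s.rep c = s.rep c' := by
  obtain ⟨u, hu, -, hmax⟩ := exists_lowest (show M.vertexHeight v < M.vertexHeight y from hc.1)
  exact (hs.rep_eq c c' ((hs.over_lowest hall hu hmax hc).trans
    (hmax _ (χ.top c').2 hc'))).symm

/-- An unprocessed point is present in the heap of the class of a component of processed points. -/
theorem mem_heap (hs : Sound χ s) {h : M.CriticalPoint} (hh : h ∉ s.processed) {y : M.Vertex}
    (hy : M.skeleton.Adj h.1 y)
    (hall : ∀ w : M.CriticalPoint, M.Beyond h.1 y w.1 → w ∈ s.processed) {c : M.Color}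
    (hc : M.Beyond h.1 y (χ.top c).1) : h ∈ s.heap (s.rep c) := by
  obtain ⟨pick, hpick, hheap⟩ := hs.exists_pick
  have hU : M.IsUpStar h.1 (M.upStar h.1 y) := M.isUpStar_iff.2 ⟨y, hy, hc.1, rfl⟩
  refine (hheap c h).2 ⟨hh, _, hU, ?_⟩
  obtain ⟨e, ⟨hel, heu⟩, he⟩ := hpick h _ hU
  rw [← he]
  have := χ.beyond_top e
  rw [hel] at this
  -- Whichever edge supplied the picked color, its maximum lies in the same processed component as
  -- that of `c`.
  exact hs.rep_eq_of_beyond hall (ReachableIn.trans heu this) hc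

/-- The class of the color of an edge ascending from an unprocessed point is attached to a point in
the component to which the edge leads. -/
theorem beyond_att (hs : Sound χ s) {h : M.CriticalPoint} (hh : h ∉ s.processed) {e : M.Edge}
    (he : e.lower = h.1) : M.Beyond h.1 e.upper (s.att (s.rep (χ.edgeColor e))).1 := by
  have htop := χ.beyond_top e
  have hov := hs.over_top (χ.edgeColor e)
  have hadj := e.adj.symm
  rw [he] at htop hadj
  rcases lt_or_ge (M.vertexHeight h.1) (M.vertexHeight (s.att (s.rep (χ.edgeColor e))).1)
    with hlt | hle
  · exact ReachableIn.trans htop (hov.beyond hlt).symm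
  -- If the attached point were not above `h`, then `h` would lie over it through the maximum of
  -- this color, and would be processed.
  · refine absurd (hs.mem_of_over _ h (hs.att_mem (χ.edgeColor e)) ?_) hh
    exact ReachableIn.trans hov ((htop.over hadj).symm.mono (M.atLeast_anti hle))

/-- Look at where the superlevel components of `a` and `w` merge. The merge point has `w` over it,
so by upward closure it cannot be processed; in particular it is not `a`. -/
theorem exists_unprocessed_under (hs : Sound χ s) {t : ℝ} {a w : M.CriticalPoint}
    (ha : a ∈ s.processed) (hw : w ∉ s.processed)
    (h : M.skeleton.ReachableIn (M.higher t) a.1 w.1) :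
    ∃ z : M.CriticalPoint, z ∉ s.processed ∧ t < M.vertexHeight z.1 ∧ M.Over z.1 a.1 := by
  obtain ⟨z, htz, hz, heq | heq | ⟨-, hcrit, hza⟩⟩ := exists_merge h
  · subst heq
    exact absurd (hs.mem_of_over a w ha hz) hw
  · subst heq
    exact ⟨w, hw, htz, hz.symm⟩
  · exact ⟨⟨z, hcrit⟩, fun hzp => hw (hs.mem_of_over _ w hzp (ReachableIn.trans hza hz)), htz, hza⟩

/-- If an ascending edge leads to a component with an unprocessed point, such a point is in the heap
of the class of its color. -/
theorem exists_mem_heap (hs : Sound χ s) {h w : M.CriticalPoint} (hh : h ∉ s.processed)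
    {e : M.Edge} (he : e.lower = h.1) (hw : w ∉ s.processed) (hb : M.Beyond h.1 e.upper w.1) :
    ∃ z ∈ s.heap (s.rep (χ.edgeColor e)), M.vertexHeight h.1 < M.vertexHeight z.1 := by
  set a := s.att (s.rep (χ.edgeColor e)) with ha
  have hap : a ∈ s.processed := hs.att_mem _
  obtain ⟨z, ⟨hz, hhz, hza⟩, hmax⟩ := Set.exists_max_image
    {z : M.CriticalPoint | z ∉ s.processed ∧ M.vertexHeight h.1 < M.vertexHeight z.1 ∧
      M.Over z.1 a.1} (fun z => M.vertexHeight z.1) (Set.toFinite _)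
    (hs.exists_unprocessed_under hap hw (ReachableIn.trans (hs.beyond_att hh he).symm hb))
  have hne : z.1 ≠ a.1 := fun heq => hz (Subtype.ext heq ▸ hap)
  obtain ⟨y, hy, hya⟩ := hza.exists_beyond hne
  refine ⟨z, hs.mem_heap hz hy (fun w' hw' => ?_) (ReachableIn.trans hya
    ((hs.over_top (χ.edgeColor e)).beyond hya.lt)), hhz⟩
  -- An unprocessed point in this component would yield another one under `a` and strictly above
  -- `z`, against the choice of `z`.
  by_contra hw'p
  obtain ⟨z', hz', hlt, hz'a⟩ :=
    hs.exists_unprocessed_under hap hw'p (ReachableIn.trans hya.symm hw')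
  exact (hmax z' ⟨hz', hhz.trans hlt, hz'a⟩).not_gt hlt

/-- The search for a ripe point makes progress: a non-ripe point has a higher one to be pushed. -/
theorem exists_isHighest (hs : Sound χ s) {h : M.CriticalPoint} (hh : h ∉ s.processed)
    {c : M.Color} (hc : c ∈ χ.col h.1) (hnot : ¬ M.IsHighest h (s.heap (s.rep c))) :
    ∃ w, M.IsHighest w (s.heap (s.rep c)) ∧ M.vertexHeight h.1 < M.vertexHeight w.1 := by
  have hz : ∃ z ∈ s.heap (s.rep c), M.vertexHeight h.1 < M.vertexHeight z.1 := by
    obtain ⟨e, he, rfl⟩ := hs.exists_edge hh hc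
    -- If the component is processed, `h` itself is in the heap and can only fail to be its highest
    -- element because of a higher one.
    by_cases hall : ∀ w : M.CriticalPoint, M.Beyond h.1 e.upper w.1 → w ∈ s.processed
    · have hmem : h ∈ s.heap (s.rep (χ.edgeColor e)) :=
        hs.mem_heap hh (he ▸ e.adj.symm) hall (he ▸ χ.beyond_top e)
      by_contra! H
      exact hnot ⟨hmem, H⟩
    · push Not at hall
      obtain ⟨w, hb, hw⟩ := hall
      exact hs.exists_mem_heap hh he hw hb
  obtain ⟨z, hz, hlt⟩ := hz
  obtain ⟨w, hw, hmax⟩ := Set.exists_max_image (s.heap (s.rep c)) (fun w => M.vertexHeight w.1)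
    (Set.toFinite _) ⟨z, hz⟩
  exact ⟨w, ⟨hw, hmax⟩, hlt.trans_le (hmax z hz)⟩

theorem isHighest_notMem (hs : Sound χ s) {w : M.CriticalPoint} {c : M.Color}
    (hw : M.IsHighest w (s.heap (s.rep c))) : w ∉ s.processed := by
  obtain ⟨pick, -, hheap⟩ := hs.exists_pick
  exact ((hheap c w).1 hw.1).1

theorem mem_processed_of_isRipe (hs : Sound χ s) {h w : M.CriticalPoint} (hh : h ∉ s.processed)
    (hr : IsRipe χ s h) {e : M.Edge} (he : e.lower = h.1) (hb : M.Beyond h.1 e.upper w.1) :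
    w ∈ s.processed := by
  by_contra hw
  obtain ⟨z, hz, hlt⟩ := hs.exists_mem_heap hh he hw hb
  exact ((hr _ (Or.inl ⟨e, he, rfl⟩)).2 z hz).not_gt hlt

/-- For a ripe point, the class of the color of an ascending edge is attached to the lowest critical
point in the component to which the edge leads. -/
theorem isLowest_att (hs : Sound χ s) {h : M.CriticalPoint} (hh : h ∉ s.processed)
    (hr : IsRipe χ s h) {e : M.Edge} (he : e.lower = h.1) {w : M.Vertex} (hw : M.IsCritical w)
    (hb : M.Beyond h.1 e.upper w) :
    M.vertexHeight (s.att (s.rep (χ.edgeColor e))).1 ≤ M.vertexHeight w := by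
  obtain ⟨u, hu, hmin, hmax⟩ := exists_lowest (show M.vertexHeight h.1 < _ from hb.1)
  exact (hs.over_lowest (fun w hw => hs.mem_processed_of_isRipe hh hr he hw) hu hmax
    (he ▸ χ.beyond_top e)).le.trans (hmin w hw hb)

theorem joinTree_adj_iff_of_isRipe (hs : Sound χ s) {h : M.CriticalPoint} (hh : h ∉ s.processed)
    (hr : IsRipe χ s h) {u : M.CriticalPoint} :
    M.joinTree.Adj u h ↔ ∃ c ∈ cur χ s h, s.att c = u := by
  rw [joinTree_adj_iff]
  constructor
  · rintro ⟨y, hy, hu, hmin⟩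
    let e : M.Edge := ⟨y, h.1, hy.symm, hu.1⟩
    refine ⟨_, ⟨χ.edgeColor e, Or.inl ⟨e, rfl, rfl⟩, rfl⟩, Subtype.ext
      (M.vertexHeight_injective (le_antisymm ?_ ?_))⟩
    · exact hs.isLowest_att hh hr (e := e) rfl u.2 hu
    · exact hmin _ (s.att _).2 (hs.beyond_att hh (e := e) rfl)
  · rintro ⟨_, ⟨c, hc, rfl⟩, rfl⟩
    obtain ⟨e, he, rfl⟩ := hs.exists_edge hh hc
    exact ⟨e.upper, he ▸ e.adj.symm, hs.beyond_att hh he,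
      fun w hw hb => hs.isLowest_att hh hr he hw hb⟩

/-- Processing a ripe point preserves the invariant. -/
theorem process (hs : Sound χ s) {h : M.CriticalPoint} (hh : h ∉ s.processed)
    (hr : IsRipe χ s h) {c₀ : M.Color} (hc₀ : c₀ ∈ cur χ s h) :
    Sound χ (s.process h (cur χ s h) c₀) := by
  classical
  set C := cur χ s h with hC
  set t := s.process h C c₀ with ht
  have hproc : t.processed = insert h s.processed := rfl
  have hrep : ∀ c, t.rep c = if s.rep c ∈ C then c₀ else s.rep c := fun c => by
    simp only [ht, BuildState.process]
  have hrep1 : ∀ {c}, s.rep c ∈ C → t.rep c = c₀ := fun hc => by rw [hrep, if_pos hc]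
  have hrep2 : ∀ {c}, s.rep c ∉ C → t.rep c = s.rep c := fun hc => by rw [hrep, if_neg hc]
  have hc₀' : s.rep c₀ = c₀ := by
    obtain ⟨c, -, rfl⟩ := hc₀
    exact hs.rep_rep c
  have hne : ∀ {c}, s.rep c ∉ C → s.rep c ≠ c₀ := fun hc heq => hc (heq ▸ hc₀)
  have hatt1 : t.att c₀ = h := Function.update_self ..
  have hatt2 : ∀ {c}, s.rep c ∉ C → t.att (s.rep c) = s.att (s.rep c) :=
    fun hc => Function.update_of_ne (hne hc) ..
  have hover : ∀ {c}, s.rep c ∈ C → M.Over h.1 (s.att (s.rep c)).1 := by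
    rintro c ⟨c', hc', heq⟩
    obtain ⟨e, he, rfl⟩ := hs.exists_edge hh hc'
    rw [← heq]
    exact (hs.beyond_att hh he).over (he ▸ e.adj.symm)
  have hedge : ∀ {y}, M.skeleton.Adj h.1 y → M.vertexHeight h.1 < M.vertexHeight y →
      ∃ e : M.Edge, e.lower = h.1 ∧ e.upper = y ∧ s.rep (χ.edgeColor e) ∈ C := fun {y} hy hlt =>
    ⟨⟨y, h.1, hy.symm, hlt⟩, rfl, rfl, Set.mem_image_of_mem _ (Or.inl ⟨_, rfl, rfl⟩)⟩
  refine ⟨?_, fun v hv => Or.inr (hs.mem_of_isMaximum v hv), ?_, ?_, ?_, ?_, ?_, ?_, ?_⟩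
  · intro c
    by_cases hc : s.rep c ∈ C
    · rw [hrep1 hc, hrep1 (by rwa [hc₀'])]
    · rw [hrep2 hc, hrep2 (by rwa [hs.rep_rep]), hs.rep_rep]
  · rintro v w (rfl | hv) hvw
    · by_cases hne : v = w
      · exact Or.inl hne.symm
      · obtain ⟨y, hy, hb⟩ := hvw.exists_beyond fun heq => hne (Subtype.ext heq)
        obtain ⟨e, he, rfl, -⟩ := hedge hy hb.1
        exact Or.inr (hs.mem_processed_of_isRipe hh hr he hb)
    · exact Or.inr (hs.mem_of_over v w hv hvw)
  · intro c
    by_cases hc : s.rep c ∈ C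
    · rw [hrep1 hc, hatt1]
      exact Or.inl rfl
    · rw [hrep2 hc, hatt2 hc]
      exact Or.inr (hs.att_mem c)
  · intro c
    by_cases hc : s.rep c ∈ C
    · rw [hrep1 hc, hatt1]
      exact (hover hc).trans (hs.over_top c)
    · rw [hrep2 hc, hatt2 hc]
      exact hs.over_top c
  · intro c c' hcc'
    by_cases hc : s.rep c ∈ C
    · rw [hrep1 hc, hatt1] at hcc'
      rw [hrep1 hc]
      refine hrep1 ?_
      -- A maximum over `h` is not `h`, so it lies in a component that an edge from `h` enters. That
      -- component is processed, hence has a single class, and this class is among those being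
      -- united.
      have hne : h.1 ≠ (χ.top c').1 := fun heq =>
        hh (hs.mem_of_isMaximum h (heq ▸ (χ.top c').2))
      obtain ⟨y, hy, hb⟩ := hcc'.exists_beyond hne
      obtain ⟨e, he, rfl, heC⟩ := hedge hy hb.1
      rwa [hs.rep_eq_of_beyond (fun w hw => hs.mem_processed_of_isRipe hh hr he hw) hb
        (he ▸ χ.beyond_top e)]
    · rw [hrep2 hc, hatt2 hc] at hcc'
      have := hs.rep_eq c c' hcc'
      rw [hrep2 hc, ← this]
      exact hrep2 (this ▸ hc)
  · rintro v (rfl | hv)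
    · obtain ⟨c, hc, heq⟩ := id hc₀
      refine ⟨c, ?_⟩
      rw [hrep1 (Set.mem_image_of_mem _ hc), hatt1]
      exact Over.refl _
    · obtain ⟨c, hcv⟩ := hs.exists_over v hv
      refine ⟨c, ?_⟩
      by_cases hc : s.rep c ∈ C
      · rw [hrep1 hc, hatt1]
        exact (hover hc).trans hcv
      · rwa [hrep2 hc, hatt2 hc]
  · obtain ⟨pick, hpick, hheap⟩ := hs.exists_pick
    refine ⟨pick, hpick, fun c v => ?_⟩
    rw [hproc, Set.mem_insert_iff, not_or]
    by_cases hc : s.rep c ∈ C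
    · have hheap' : t.heap c₀ = ⋃ c' ∈ C, s.heap c' \ {h} := by
        simp only [ht, BuildState.process, if_true]
      have hiff : ∀ b, t.rep b = c₀ ↔ s.rep b ∈ C := fun b =>
        ⟨fun hb => by_contra fun hbC => hne hbC ((hrep2 hbC).symm.trans hb), hrep1⟩
      simp only [hrep1 hc, hheap', hiff, Set.mem_iUnion, Set.mem_sdiff, Set.mem_singleton_iff,
        exists_prop]
      constructor
      · rintro ⟨_, ⟨c', hc', rfl⟩, hv, hvh⟩
        obtain ⟨hvp, U, hU, heq⟩ := (hheap c' v).1 hv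
        exact ⟨⟨hvh, hvp⟩, U, hU, heq ▸ Set.mem_image_of_mem _ hc'⟩
      · rintro ⟨⟨hvh, hvp⟩, U, hU, hUC⟩
        exact ⟨_, hUC, (hheap _ v).2 ⟨hvp, U, hU, rfl⟩, hvh⟩
    · have hheap' : t.heap (s.rep c) = s.heap (s.rep c) := by
        simp only [ht, BuildState.process, if_neg (hne hc), if_neg hc]
      have hiff : ∀ b, t.rep b = s.rep c ↔ s.rep b = s.rep c := by
        intro b
        by_cases hb : s.rep b ∈ C
        · rw [hrep1 hb]
          exact ⟨fun heq => absurd heq.symm (hne hc), fun heq => absurd (heq ▸ hb) hc⟩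
        · rw [hrep2 hb]
      simp only [hrep2 hc, hheap', hiff, hheap]
      refine ⟨fun ⟨hvp, U, hU, heq⟩ => ⟨⟨?_, hvp⟩, U, hU, heq⟩, fun ⟨hv, h⟩ => ⟨hv.2, h⟩⟩
      -- `h` is deleted only from the heaps of classes in `C`. It is in no other heap, because a
      -- color picked for one of its up-stars touches `h`.
      rintro rfl
      obtain ⟨e, he, heU⟩ := hpick v U hU
      obtain ⟨y, -, -, rfl⟩ := M.isUpStar_iff.1 hU
      refine hc (heq ▸ Set.mem_image_of_mem _ ?_)
      exact Or.inl ⟨e, he.1, heU⟩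
  · intro u v
    have hout : t.output.Adj u v ↔ s.output.Adj u v ∨ (v = h ∧ ∃ c ∈ C, s.att c = u) := Iff.rfl
    rw [hout, hs.output_adj, hproc, Set.mem_insert_iff, or_and_right, or_comm]
    refine or_congr_left (and_congr_right ?_)
    rintro rfl
    exact (hs.joinTree_adj_iff_of_isRipe hh hr).symm

end Sound

/-! ### Runs of `build` -/

/-- The stack consists of unprocessed points whose heights increase towards the head. -/
def StackSound (s : M.BuildState) (K : List M.CriticalPoint) : Prop :=
  K.Pairwise (fun a b => M.vertexHeight b.1 < M.vertexHeight a.1) ∧ ∀ v ∈ K, v ∉ s.processed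

theorem StackSound.length_le {s : M.BuildState} {K : List M.CriticalPoint} (h : StackSound s K) :
    K.length ≤ Nat.card M.CriticalPoint := by
  have := Fintype.ofFinite M.CriticalPoint
  rw [Nat.card_eq_fintype_card]
  refine List.Nodup.length_le_card (h.1.imp ?_)
  rintro a b hlt rfl
  exact lt_irrefl _ hlt

/-- The invariant of `build`. -/
def Config.Sound : M.Config → Prop
  | .painting s => s.Valid
  | .painted _ => True
  | .main χ s => PLComplex.Sound χ s ∧ StackSound s s.stack
  | .update χ s => PLComplex.Sound χ s ∧ StackSound s s.stack ∧ s.stack ≠ []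
  | .popped χ s h => PLComplex.Sound χ s ∧ StackSound s (h :: s.stack) ∧ IsRipe χ s h
  | .halted J => J = M.joinTree

/-- A quantity decreasing in every step of `build`. -/
noncomputable def Config.potential : M.Config → ℕ
  | .painting s => Nat.card M.CriticalPoint * (Nat.card M.CriticalPoint + 4) +
      Nat.card M.CriticalPoint + 5 + s.potential
  | .painted _ => Nat.card M.CriticalPoint * (Nat.card M.CriticalPoint + 4) +
      Nat.card M.CriticalPoint + 4
  | .main _ s => s.processedᶜ.ncard * (Nat.card M.CriticalPoint + 4) +
      Nat.card M.CriticalPoint + 3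
  | .update _ s => s.processedᶜ.ncard * (Nat.card M.CriticalPoint + 4) +
      (Nat.card M.CriticalPoint - s.stack.length) + 1
  | .popped _ s _ => s.processedᶜ.ncard * (Nat.card M.CriticalPoint + 4)
  | .halted _ => 0

theorem Config.sound_start : (Config.start M).Sound :=
  ⟨nofun, nofun, nofun, fun _ h => absurd rfl h, fun _ h => absurd rfl h⟩

theorem Step.sound {a b : M.Config} (h : M.Step a b) (ha : a.Sound) : b.Sound := by
  cases h with
  | paint s t h => exact h.valid ha
  | painted => trivial
  | init χ s hs =>
    refine ⟨hs.sound, ?_⟩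
    rw [hs.2.2.2.1]
    exact ⟨.nil, nofun⟩
  | finish χ s hs =>
    refine Digraph.ext (funext₂ fun u v => propext ?_)
    rw [ha.1.output_adj]
    exact and_iff_right (hs v)
  | callEmpty χ s v hv hs =>
    refine ⟨ha.1.with_stack _, ⟨List.pairwise_singleton _ _, fun w hw => ?_⟩,
      List.cons_ne_nil _ _⟩
    rw [List.mem_singleton.1 hw]
    exact hv
  | call χ s v hv hs => exact ⟨ha.1, ha.2, hs⟩
  | push χ s h w K c hs hc hh hw =>
    obtain ⟨hsound, ⟨hpw, hK⟩, -⟩ := ha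
    rw [hs] at hpw hK
    refine ⟨hsound.with_stack _, ⟨List.pairwise_cons.2 ⟨fun v hv => ?_, hpw⟩, fun v hv => ?_⟩,
      List.cons_ne_nil _ _⟩
    · obtain ⟨w', hw', hlt⟩ := hsound.exists_isHighest (hK h (by simp)) hc hh
      replace hlt := hlt.trans_le (hw.2 w' hw'.1)
      rcases List.mem_cons.1 hv with rfl | hv
      · exact hlt
      · exact ((List.pairwise_cons.1 hpw).1 v hv).trans hlt
    · rcases List.mem_cons.1 hv with rfl | hv
      · exact hsound.isHighest_notMem hw
      · exact hK v hv
  | pop χ s h K hs hh =>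
    obtain ⟨hsound, hK, -⟩ := ha
    rw [hs] at hK
    exact ⟨hsound.with_stack _, hK, hh⟩
  | process χ s h c₀ hc₀ =>
    obtain ⟨hsound, ⟨hpw, hK⟩, hr⟩ := ha
    have hpw := List.pairwise_cons.1 hpw
    refine ⟨hsound.process (hK h (by simp)) hr hc₀, hpw.2, fun v hv => ?_⟩
    rintro (rfl | hvp)
    · exact lt_irrefl _ (hpw.1 v hv)
    · exact hK v (List.mem_cons_of_mem _ hv) hvp

/-- With `N` critical points, processing one frees `N + 4` units, which pays for the `N + 3` granted
at the next loop test; these cover at most `N` pushes and the control steps. -/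
theorem Step.potential_lt {a b : M.Config} (h : M.Step a b) (ha : a.Sound) :
    b.potential < a.potential := by
  have hb := h.sound ha
  cases h with
  | paint s t h => exact Nat.add_lt_add_left h.potential_lt _
  | painted => simp only [Config.potential]; omega
  | init χ s hs =>
    have := Nat.mul_le_mul_right (Nat.card M.CriticalPoint + 4) (Set.ncard_le_card s.processedᶜ)
    simp only [Config.potential]
    omega
  | finish => simp only [Config.potential]; omega
  | callEmpty => simp only [Config.potential]; omega
  | call => simp only [Config.potential]; omega
  | push χ s h w K c hs hc hh hw =>
    -- The truncated difference strictly decreases because even the new stack has at most as many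
    -- entries as there are critical points.
    have := hb.2.1.length_le
    simp only [List.length_cons] at this
    simp only [Config.potential, hs, List.length_cons]
    omega
  | pop => simp only [Config.potential]; omega
  | process χ s h c₀ hc₀ =>
    have hmem : h ∈ s.processedᶜ := ha.2.1.2 h (by simp)
    have hcard := Set.ncard_sdiff_singleton_add_one hmem
    have heq : (s.process h (cur χ s h) c₀).processedᶜ = s.processedᶜ \ {h} := by
      ext v
      simp [BuildState.process, and_comm]
    simp only [Config.potential, heq]
    rw [← hcard, add_mul]
    omega

theorem Config.Sound.exists_step {a : M.Config} (ha : a.Sound) (hend : ∀ b, ¬ M.Step a b) :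
    a = Config.halted M.joinTree := by
  classical
  cases a with
  | painting s =>
    rcases PaintState.Valid.exists_step ha with ⟨t, ht⟩ | ⟨hq, χ, hx, he⟩
    · exact absurd (.paint s t ht) (hend _)
    · exact absurd (.painted s χ hq hx he) (hend _)
  | painted χ =>
    have hpick : ∀ (v : M.CriticalPoint) (U : Set M.Edge), ∃ c, M.IsUpStar v.1 U →
        c ∈ χ.edgeColor '' U := by
      intro v U
      by_cases hU : M.IsUpStar v.1 U
      · obtain ⟨e, he⟩ := hU.1
        exact ⟨_, fun _ => Set.mem_image_of_mem _ he⟩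
      -- Default value for sets that are not up-stars: some color exists because there is a maximum
      -- over `v`.
      · obtain ⟨x, hx, -⟩ := exists_isMaximum_reachableIn v.1
        exact ⟨χ.maxColor ⟨x, hx⟩, fun h => absurd h hU⟩
    choose pick hpick using hpick
    refine absurd (.init χ ⟨fun c => {v | ∃ U, M.IsUpStar v.1 U ∧ pick v U = c}, id,
      fun c => (χ.top c).toCritical, [], {v | M.IsMaximum v.1}, { Adj := fun _ _ => False }⟩
      ⟨⟨pick, hpick, fun _ => rfl⟩, fun _ => rfl, fun x => ?_, rfl, rfl, rfl⟩) (hend _)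
    simp only [InitialPainting.top_maxColor]
  | main χ s =>
    by_cases hall : ∀ v, v ∈ s.processed
    · exact absurd (.finish χ s hall) (hend _)
    · push Not at hall
      obtain ⟨v, hv⟩ := hall
      by_cases hstack : s.stack = []
      · exact absurd (.callEmpty χ s v hv hstack) (hend _)
      · exact absurd (.call χ s v hv hstack) (hend _)
  | update χ s =>
    obtain ⟨hsound, hK, hne⟩ := ha
    obtain ⟨h, K, hs⟩ := List.exists_cons_of_ne_nil hne
    by_cases hr : IsRipe χ s h
    · exact absurd (.pop χ s h K hs hr) (hend _)
    · unfold IsRipe at hr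
      push Not at hr
      obtain ⟨c, hc, hh⟩ := hr
      obtain ⟨w, hw, -⟩ := hsound.exists_isHighest (hK.2 h (by simp [hs])) hc hh
      exact absurd (.push χ s h w K c hs hc hh hw) (hend _)
  | popped χ s h =>
    obtain ⟨hsound, hK, -⟩ := ha
    -- Being unprocessed, `h` has an ascending edge, so `cur χ s h` contains a candidate for the new
    -- representative.
    have hmax : ¬ M.IsMaximum h.1 := fun hm => hK.2 h (by simp) (hsound.mem_of_isMaximum h hm)
    rw [isMaximum_iff] at hmax
    push Not at hmax
    obtain ⟨y, hy, hle⟩ := hmax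
    have hlt := hle.lt_of_ne fun heq => hy.1 (M.vertexHeight_injective heq)
    exact absurd (.process χ s h _ (Set.mem_image_of_mem _
      (Or.inl ⟨⟨y, h.1, hy.symm, hlt⟩, rfl, rfl⟩))) (hend _)
  | halted J => rw [show J = M.joinTree from ha]

end PLComplex

theorem mainTheorem5 {d : ℕ} (M : PLComplex d) :
    -- no run of the procedure is infinite
    (¬ ∃ run : ℕ → M.Config, run 0 = PLComplex.Config.start M ∧
      ∀ n, M.Step (run n) (run (n + 1))) ∧
    -- a run can only end with the procedure returning the join tree
    ∀ s : M.Config, Relation.ReflTransGen M.Step (PLComplex.Config.start M) s →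
      (∀ s', ¬ M.Step s s') → s = PLComplex.Config.halted M.joinTree := by
  constructor
  · rintro ⟨run, h0, hstep⟩
    have hsound : ∀ n, (run n).Sound := by
      intro n
      induction n with
      | zero => rw [h0]; exact PLComplex.Config.sound_start
      | succ n ih => exact (hstep n).sound ih
    exact not_strictAnti_of_wellFoundedLT (fun n => (run n).potential)
      (strictAnti_nat_of_succ_lt fun n => (hstep n).potential_lt (hsound n))
  · intro s hs hend
    refine PLComplex.Config.Sound.exists_step ?_ hend
    clear hend
    induction hs with
    | refl => exact PLComplex.Config.sound_start
    | tail _ h ih => exact h.sound ih
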